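/- **Setting.** Let $\mathcal M=(E,\mathcal I)$ be a loopless matroid on a finite ground set, with set of bases $\mathcal B$ and rank $D$. Write $B-x+e=(B\setminus\{x\})\cup\{e\}$ and $w_I=\sum_{e\in I}w_e$ for $w\in\mathbb R^E$. Let $\mu\in(0,\infty)^E$ have pairwise distinct entries and let $B^*\in\mathcal B$ be the unique maximiser of $I\mapsto\mu_I$ over $\mathcal I$. For $e\notin B^*$ put $\sigma(e)=\operatorname{argmin}\{\mu_x: x\in B^*,\ B^*-x+e\in\mathcal B\}$, and let $\Delta_{\min}=\min_{e\notin B^*}(\mu_{\sigma(e)}-\mu_e)$. The reward vectors $(X_e(t))_{e\in E}$, $t=0,1,2,\dots$, are independent over $t$ (rewards of different elements at the same time may be dependent). For each $e$ the $X_e(t)$ are identically distributed with mean $\mu_e$, and $X_e(t)-\mu_e$ is sub-Gaussian with variance proxy $1/4$, i.e. $\mathbb E\,e^{\lambda(X_e(t)-\mu_e)}\le e^{\lambda^2/8}$ for all $\lambda\in\mathbb R$ (for instance, $X_e(t)\in[0,1]$). **Algorithm MAUB.** In an initialisation (time $0$) every element $e$ is played once, as the independent set $\{e\}$, and $X_e(0)$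 is observed. At each time $t\ge 1$ there are a leader $L(t)\in\mathcal B$ and a played base $P(t)$, and the rewards $X_e(t)$, $e\in P(t)$, are observed. Let $N_e(t)=1+\#\{1\le s\le t: e\in P(s)\}$, let $\hat\mu_e(t)$ be the average of the $N_e(t)$ rewards of $e$ observed up to time $t$, and let $l_B(t)=\#\{1\le s\le t: L(s)=B\}$. - $\mathrm{greedy}(w)$ goes through $E$ in nonincreasing order of $w$, starting from the empty set, and adds an element whenever the result is independent. - $\mathrm{Nbr}(B,w)$ goes through $x\in B$ in nondecreasing order of $w$. For each $x$ it collects $B-x+e$ for every not yet mapped $e\in E\setminus B$ with $B-x+e\in\mathcal B$, and marks these $e$ as mapped. Initially $L=\mathrm{greedy}(\hat\mu(0))$ and $\mathcal N=\mathrm{Nbr}(L,\hat\mu(0))$. At time $t\ge1$: 1. If some $B\in\mathcal N$ has $\hat\mu_B(t-1)>\hat\mu_L(t-1)$, then $L\leftarrow\mathrm{greedy}(\hat\mu(t-1))$ and $\mathcal N\leftarrow\mathrm{Nbr}(L,\hat\mu(t-1))$. Otherwise $L$ is kept. In that case, if the order of the elements of $L$ used to compute $\mathcal N$ is no longer nondecreasing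 for $\hat\mu(t-1)$, then $\mathcal N\leftarrow\mathrm{Nbr}(L,\hat\mu(t-1))$, and otherwise $\mathcal N$ is kept too. 2. Set $L(t)=L$. If $|E|-D+1$ divides $l_{L}(t)-1$, then $P(t)=L$. Otherwise $P(t)$ maximises over $B\in\{L\}\cup\mathcal N$ the index $\sum_{e\in B}\Big(\hat\mu_e(t-1)+\sqrt{2\log l_{L}(t)/N_e(t-1)}\Big)$. Ties are broken arbitrarily, by rules that do not use future rewards. The pseudo-regret is $$R(T)=\sum_{e\in E}\Big(\max_{I\in\mathcal I}\mu_I-\mu_e\Big)+\sum_{t=1}^{T}\Big(\max_{I\in\mathcal I}\mu_I-\mu_{P(t)}\Big),$$ where the first sum is the regret of the initialisation. **Theorem.** For every $e\notin B^*$, $\sigma(e)$ is well defined and $\mu_{\sigma(e)}>\mu_e$. For every $T$, $R(T)$ is integrable, and as $T\to\infty$, for the fixed problem instance, $$\mathbb E[R(T)]\ \le\ \sum_{e\notin B^*}\frac{8}{\mu_{\sigma(e)}-\mu_e}\,\log T+o(\log T),\qquad \sum_{e\notin B^*}\frac{8}{\mu_{\sigma(e)}-\mu_e}\ \le\ \frac{8(|E|-D)}{\Delta_{\min}}$$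 (if $B^*=E$, both sides of the second inequality are read as $0$). In particular, if $B^*\ne E$, $$\mathbb E[R(T)]=\mathcal O\Big(\sum_{e\notin B^*}\frac{8}{\mu_{\sigma(e)}-\mu_e}\log T\Big)\qquad\text{and}\qquad\mathbb E[R(T)]=\mathcal O\Big(\frac{|E|-D}{\Delta_{\min}}\log T\Big).$$ -/

import Mathlib

open MeasureTheory ProbabilityTheory Filter Asymptotics

namespace MAUB

noncomputable section

variable {α : Type*} [Fintype α] [DecidableEq α]

/-- Additive value `w_I = ∑_{e ∈ I} w_e` of a set of elements. -/
def value (w : α → ℝ) (I : Finset α) : ℝ := ∑ e ∈ I, w e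

/-- The rank `D` of the matroid (the common size of its bases). -/
def rank (M : Matroid α) : ℕ := M.eRank.toNat

/-- `B - x + e`. -/
def swap (B : Finset α) (x e : α) : Finset α := insert e (B.erase x)

/-- `max_{I ∈ 𝓘} w_I`, the largest value of an independent set. -/
def optValue (M : Matroid α) (w : α → ℝ) : ℝ :=
  ⨆ I : {I : Finset α // M.Indep (I : Set α)}, value w I.1

open Classical in
/-- The elements `x ∈ B` that can be exchanged for `e`, i.e. `B - x + e` is a base. -/
def exchangeable (M : Matroid α) (B : Finset α) (e : α) : Finset α :=
  B.filter fun x => M.IsBase (swap B x e : Set α)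

open Classical in
/-- `σ_{B,w}(e) = argmin {w_x : x ∈ B, B - x + e is a base}` for `e ∉ B`
(and `e` itself if there is no such `x`, which does not happen for bases of loopless matroids). -/
def sigma (M : Matroid α) (B : Finset α) (w : α → ℝ) (e : α) : α :=
  if h : (exchangeable M B e).Nonempty then
    (Finset.exists_min_image (exchangeable M B e) w h).choose
  else e

/-- The gap `w_{σ(e)} - w_e`. -/
def gap (M : Matroid α) (B : Finset α) (w : α → ℝ) (e : α) : ℝ :=
  w (sigma M B w e) - w e

/-- `Δ_min = min_{e ∉ B} (w_{σ(e)} - w_e)`. -/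
def minGap (M : Matroid α) (B : Finset α) (w : α → ℝ) : ℝ :=
  ⨅ e : {e : α // e ∉ B}, gap M B w e.1

/-! ### The two subroutines -/

open Classical in
/-- The loop of the greedy algorithm, along a given enumeration of the elements. -/
def greedyLoop (M : Matroid α) (l : List α) : Finset α :=
  l.foldl (fun B e => if M.Indep (insert e B : Finset α) then insert e B else B) ∅

/-- `B` is an output of the greedy algorithm for the values `w`: it is produced by the greedy loop
along an enumeration of all elements in nonincreasing order of value (ties in any order). -/
def IsGreedyOutput (M : Matroid α) (w : α → ℝ) (B : Finset α) : Prop :=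
  ∃ l : List α, l.Nodup ∧ (∀ e, e ∈ l) ∧ l.Pairwise (fun a b => w b ≤ w a) ∧ greedyLoop M l = B

/-- `q` enumerates `B` as `x₁, x₂, …` with `w x₁ ≤ w x₂ ≤ …`. -/
def IsIncreasingOrder (w : α → ℝ) (B : Finset α) (q : List α) : Prop :=
  q.Nodup ∧ q.toFinset = B ∧ q.Pairwise (fun a b => w a ≤ w b)

open Classical in
/-- Neighbourhood computation for the base `B` whose elements are visited in the order `q`.
The loop state is the pair (`Neighbors`, `NotMapped`). -/
def computeNeighbors (M : Matroid α) (B : Finset α) (q : List α) : Finset (Finset α) :=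
  (q.foldl (fun (S : Finset (Finset α) × Finset α) x =>
      (S.1 ∪ (S.2.filter fun e => M.IsBase (swap B x e : Set α)).image (swap B x),
       S.2.filter fun e => ¬ M.IsBase (swap B x e : Set α)))
    (∅, Finset.univ \ B)).1

/-! ### Statistics along one sample path

`x e t` is the reward of `e` at time `t`, `P t` the base played and `L t` the leader at time
`t ≥ 1`.  Time `0` stands for the initialisation, in which every element is played once. -/

/-- `N_e(t)`: number of times `e` was played, up to time `t`. -/
def plays (P : ℕ → Finset α) (e : α) (t : ℕ) : ℕ :=
  1 + ((Finset.Icc 1 t).filter fun s => e ∈ P s).card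

/-- `μ̂_e(t)`: average of the rewards of `e` observed up to time `t`. -/
def empMean (x : α → ℕ → ℝ) (P : ℕ → Finset α) (t : ℕ) (e : α) : ℝ :=
  (x e 0 + ∑ s ∈ (Finset.Icc 1 t).filter (fun s => e ∈ P s), x e s) / plays P e t

/-- `l_B(t)`: number of times `s ∈ {1, …, t}` at which `B` was the leader. -/
def leaderTime (L : ℕ → Finset α) (B : Finset α) (t : ℕ) : ℕ :=
  ((Finset.Icc 1 t).filter fun s => L s = B).card

/-- The optimistic value of `B` at time `t + 1` when the leader is `L (t + 1)`:
`∑_{e ∈ B} (μ̂_e(t) + √(2 log l_{L(t+1)}(t+1) / N_e(t)))`. -/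
def optimisticValue (x : α → ℕ → ℝ) (L P : ℕ → Finset α) (t : ℕ) (B : Finset α) : ℝ :=
  ∑ e ∈ B, (empMean x P t e +
    Real.sqrt (2 * Real.log (leaderTime L (L (t + 1)) (t + 1)) / plays P e t))

/-- `(L, q, N, P)` is an execution of MAUB on the reward path `x`, with arbitrary tie-breaking:
`L t` is the leader, `N t` the current neighbourhood, `q t` the order of the leader's elements used
to compute it, and `P t` the base played at time `t ≥ 1`.  The values `L 0`, `q 0`, `N 0` are those
set before the main loop, and `P 0` is irrelevant. -/
structure IsExecution (M : Matroid α) (x : α → ℕ → ℝ) (L : ℕ → Finset α) (q : ℕ → List α)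
    (N : ℕ → Finset (Finset α)) (P : ℕ → Finset α) : Prop where
  init_leader : IsGreedyOutput M (empMean x P 0) (L 0)
  init_order : IsIncreasingOrder (empMean x P 0) (L 0) (q 0)
  init_nbrs : N 0 = computeNeighbors M (L 0) (q 0)
  /-- some neighbour has a larger empirical value: recompute leader and neighbourhood -/
  new_leader : ∀ t,
    (∃ B ∈ N t, value (empMean x P t) (L t) < value (empMean x P t) B) →
      IsGreedyOutput M (empMean x P t) (L (t + 1)) ∧
      IsIncreasingOrder (empMean x P t) (L (t + 1)) (q (t + 1)) ∧
      N (t + 1) = computeNeighbors M (L (t + 1)) (q (t + 1))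
  /-- otherwise the leader stays -/
  same_leader : ∀ t,
    (¬ ∃ B ∈ N t, value (empMean x P t) (L t) < value (empMean x P t) B) → L (t + 1) = L t
  /-- the leader stays, but the order of its elements has changed: recompute the neighbourhood -/
  new_nbrs : ∀ t,
    (¬ ∃ B ∈ N t, value (empMean x P t) (L t) < value (empMean x P t) B) →
    ¬ (q t).Pairwise (fun a b => empMean x P t a ≤ empMean x P t b) →
      IsIncreasingOrder (empMean x P t) (L (t + 1)) (q (t + 1)) ∧
      N (t + 1) = computeNeighbors M (L (t + 1)) (q (t + 1))
  /-- the leader stays and so does the order of its elements: nothing changes -/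
  same_nbrs : ∀ t,
    (¬ ∃ B ∈ N t, value (empMean x P t) (L t) < value (empMean x P t) B) →
    (q t).Pairwise (fun a b => empMean x P t a ≤ empMean x P t b) →
      q (t + 1) = q t ∧ N (t + 1) = N t
  /-- once every `|E| - D + 1` rounds of leadership, the leader is played -/
  play_leader : ∀ t,
    (Fintype.card α - rank M + 1) ∣ (leaderTime L (L (t + 1)) (t + 1) - 1) → P (t + 1) = L (t + 1)
  /-- otherwise a base of largest optimistic value among the leader and its neighbours is played -/
  play_optimistic : ∀ t,
    ¬ (Fintype.card α - rank M + 1) ∣ (leaderTime L (L (t + 1)) (t + 1) - 1) →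
      P (t + 1) ∈ insert (L (t + 1)) (N (t + 1)) ∧
      ∀ B ∈ insert (L (t + 1)) (N (t + 1)),
        optimisticValue x L P t B ≤ optimisticValue x L P t (P (t + 1))

/-- The pseudo-regret up to time `T`: the initialisation, which plays each element once (as the
independent set `{e}`), and the rounds `1, …, T`. -/
def regret (M : Matroid α) (w : α → ℝ) (P : ℕ → Finset α) (T : ℕ) : ℝ :=
  ∑ e, (optValue M w - value w {e}) + ∑ s ∈ Finset.Icc 1 T, (optValue M w - value w (P s))

/-! ### The random environment -/

variable {Ω : Type*} [mΩ : MeasurableSpace Ω]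

/-- Stochastic semi-bandit rewards with means `w`.  The filtration `ℱ t` is the information
available after time `t`: it contains the rewards up to time `t`, and the reward vector at time
`t + 1` is independent of it (so the reward vectors are independent over time; the rewards of
different elements at the same time may be dependent).  The rewards of each element are identically
distributed, and sub-Gaussian with the variance proxy `1/4` of Hoeffding's lemma for
`[0,1]`-valued variables. -/
structure IsEnvironment (Pr : Measure Ω) (ℱ : Filtration ℕ mΩ) (X : α → ℕ → Ω → ℝ)
    (w : α → ℝ) : Prop where
  adapted : ∀ e t, Measurable[ℱ t] (X e t)
  indep : ∀ t, Indep (MeasurableSpace.comap (fun ω e => X e (t + 1) ω) MeasurableSpace.pi) (ℱ t) Pr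
  identDistrib : ∀ e t, IdentDistrib (X e t) (X e 0) Pr Pr
  mean : ∀ e t, ∫ ω, X e t ω ∂Pr = w e
  subGaussian : ∀ e t, HasSubgaussianMGF (fun ω => X e t ω - w e) (1 / 4) Pr

/-- MAUB run in the random environment `X`: every realisation is an execution, and the decisions
made at time `t + 1` (ties included) depend only on the information available after time `t`. -/
structure IsMAUB (M : Matroid α) (ℱ : Filtration ℕ mΩ) (X : α → ℕ → Ω → ℝ)
    (L : ℕ → Ω → Finset α) (q : ℕ → Ω → List α) (N : ℕ → Ω → Finset (Finset α))
    (P : ℕ → Ω → Finset α) : Prop where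
  execution : ∀ ω, IsExecution M (fun e t => X e t ω) (fun t => L t ω) (fun t => q t ω)
    (fun t => N t ω) (fun t => P t ω)
  init_measurable : ∀ B l S, MeasurableSet[ℱ 0] {ω | L 0 ω = B ∧ q 0 ω = l ∧ N 0 ω = S}
  predictable : ∀ t B l S J, MeasurableSet[ℱ t]
    {ω | L (t + 1) ω = B ∧ q (t + 1) ω = l ∧ N (t + 1) ω = S ∧ P (t + 1) ω = J}

end

end MAUB

/-!
# A regret bound for MAUB

The regret is bounded path by path, with a random constant whose expectation is finite.

Choose `ε` so that distinct means differ by at least `4 ε`. Call a path typical with threshold `V`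
(`IsTypicalPath`) if the empirical mean of every element with more than `V` samples is `ε`-accurate
and if, for every `s > V`, the index of an element with at most `s` samples and bonus based on
`log s` is at least its mean. A Chernoff bound for the exponential supermartingale of the samples of
an element, stopped after `n` of them (`IsMAUB.measure_exponent_ge_le`), makes the failure
probabilities of these events so small that almost every path is typical for a threshold `V` of
finite expectation (`IsMAUB.exists_isTypicalPath`). No optional skipping is needed, since the
decision to sample an element is predictable.

On a typical path, the forced play of the leader every `|E| - D + 1` leaderships makes the estimates
of the elements of a leader `B` accurate once `B` has led a multiple of `V` times. From then on the
neighbourhood is the one computed from the true means, `{B - σ(e) + e : e ∉ B}`. Two cases remain.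

* If `B` is not optimal, then some swap `B - σ(e) + e` improves on it
  (`exists_improving_swap`). Had such an `e` been estimated accurately, the leader would have been
  replaced; so `e` has few samples, its index is at least `μ e`, and the swap that is played brings
  in an element with at most `V + O(log s)` samples, where `s` is the number of leaderships of `B`
  (`IsTypicalPath.suboptimal_round`). Each such round uses up a sample, and forced plays are at most
  about half of the leaderships, so `B` leads `O(1 + V)` rounds in all
  (`IsTypicalPath.leaderTime_le`).
* If `B` is optimal, then `e ∉ B` is played only while it has at most `V + 8 log T / gap(e) ^ 2`
  samples (`IsTypicalPath.optimal_round`), at a cost of `gap(e)` each time.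

Summing up, the regret is at most `∑ 8 / gap(e) * log T + C (1 + V)` (`exists_regret_le`), and the
theorem follows by taking expectations: the remainder term is bounded.
-/

namespace MAUB

/-! ### Exchange of elements in bases -/

lemma rank_eq_card {α : Type*} {M : Matroid α} {B : Finset α} (hB : M.IsBase (B : Set α)) :
    rank M = B.card := by
  rw [rank, ← hB.encard_eq_eRank, Set.encard_coe_eq_coe_finsetCard, ENat.toNat_natCast]

section Exchange

variable {α : Type*} [DecidableEq α] {M : Matroid α} {B : Finset α} {w : α → ℝ} {x e : α}

lemma mem_swap {y : α} : y ∈ swap B x e ↔ y = e ∨ y ≠ x ∧ y ∈ B := by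
  simp [swap]

lemma value_swap (w : α → ℝ) (hx : x ∈ B) (he : e ∉ B) :
    value w (swap B x e) = value w B - w x + w e := by
  have h : e ∉ B.erase x := fun h => he (Finset.mem_of_mem_erase h)
  rw [value, swap, Finset.sum_insert h, value, ← Finset.add_sum_erase B w hx]
  ring

lemma swap_ne (he : e ∉ B) : swap B x e ≠ B := by
  intro h
  exact he (h ▸ Finset.mem_insert_self _ _)

/-- The extension of `(I ∩ B) ∪ {e}` to a base inside `B ∪ {e}` loses exactly one element of `B`,
and that element lies outside `I`. -/
lemma exists_swap_isBase (hB : M.IsBase (B : Set α)) {I : Set α} (hI : M.Indep I) (heI : e ∈ I)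
    (heB : e ∉ B) : ∃ f ∈ B, f ∉ I ∧ M.IsBase (swap B f e : Set α) := by
  have hJ : M.Indep (insert e (I ∩ B)) :=
    hI.subset (Set.insert_subset heI Set.inter_subset_left)
  obtain ⟨B', hB', hJB', hB'J⟩ := hJ.exists_isBase_subset_union_isBase hB
  have heB' : e ∈ B' := hJB' (Set.mem_insert _ _)
  have hnot : ¬ (B : Set α) ⊆ B' := by
    intro h
    have := hB.eq_of_subset_isBase hB' h
    exact heB (by simpa [← this] using heB')
  obtain ⟨f, hfB, hfB'⟩ := Set.not_subset.1 hnot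
  refine ⟨f, hfB, fun hfI => hfB' (hJB' (Set.mem_insert_of_mem _ ⟨hfI, hfB⟩)), ?_⟩
  have hsub : B' ⊆ (swap B f e : Set α) := by
    intro y hy
    have hy' := hB'J hy
    have hyf : y ≠ f := fun h => hfB' (h ▸ hy)
    simp only [Finset.mem_coe, mem_swap]
    simp only [Set.mem_union, Set.mem_insert_iff, Set.mem_inter_iff, Finset.mem_coe] at hy'
    tauto
  have hcard : (swap B f e : Set α).encard ≤ B'.encard := by
    rw [hB'.encard_eq_encard_of_isBase hB, Set.encard_coe_eq_coe_finsetCard,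
      Set.encard_coe_eq_coe_finsetCard, swap,
      Finset.card_insert_of_notMem (fun h => heB (Finset.mem_of_mem_erase h)),
      Finset.card_erase_add_one (by exact_mod_cast hfB)]
  have heq := (Finset.finite_toSet _).eq_of_subset_of_encard_le' hsub hcard
  rwa [← heq]

lemma exchangeable_nonempty (hE : M.E = Set.univ) (hM : M.Loopless)
    (hB : M.IsBase (B : Set α)) (he : e ∉ B) : (exchangeable M B e).Nonempty := by
  have hI : M.Indep {e} := M.subsingleton_indep (by simp) (by simp [hE])
  obtain ⟨f, hf, -, hb⟩ := exists_swap_isBase hB hI (Set.mem_singleton e) he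
  exact ⟨f, by simp [exchangeable, hf, hb]⟩

lemma sigma_mem (h : (exchangeable M B e).Nonempty) : sigma M B w e ∈ exchangeable M B e := by
  rw [sigma, dif_pos h]
  exact (Finset.exists_min_image (exchangeable M B e) w h).choose_spec.1

lemma sigma_le (hx : x ∈ exchangeable M B e) : w (sigma M B w e) ≤ w x := by
  have h : (exchangeable M B e).Nonempty := ⟨x, hx⟩
  rw [sigma, dif_pos h]
  exact (Finset.exists_min_image (exchangeable M B e) w h).choose_spec.2 x hx

lemma mem_exchangeable : x ∈ exchangeable M B e ↔ x ∈ B ∧ M.IsBase (swap B x e : Set α) := by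
  simp [exchangeable]

/-- A base other than the optimal one `Bs` is improved by a single swap: the heaviest element on
which the two bases differ must belong to `Bs`, and it can be swapped into `B`. -/
lemma exists_improving_swap (hw : Function.Injective w) {Bs : Finset α}
    (hBs : M.IsBase (Bs : Set α))
    (hmax : ∀ I : Finset α, M.Indep (I : Set α) → I ≠ Bs → value w I < value w Bs)
    (hB : M.IsBase (B : Set α)) (hne : B ≠ Bs) :
    ∃ e, e ∉ B ∧ ∃ x ∈ exchangeable M B e, w x < w e := by
  have hD : ((B \ Bs) ∪ (Bs \ B)).Nonempty := by
    by_contra h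
    rw [Finset.not_nonempty_iff_eq_empty, Finset.union_eq_empty, Finset.sdiff_eq_empty_iff_subset,
      Finset.sdiff_eq_empty_iff_subset] at h
    exact hne (h.1.antisymm h.2)
  obtain ⟨e, he, hemax⟩ := Finset.exists_max_image _ w hD
  rcases Finset.mem_union.1 he with he | he
  · rw [Finset.mem_sdiff] at he
    obtain ⟨f, hf, hfB, hb⟩ := exists_swap_isBase hBs hB.indep (Finset.mem_coe.2 he.1) he.2
    have h1 := hmax _ hb.indep (swap_ne he.2)
    rw [value_swap w hf he.2] at h1
    have h2 := hemax f (Finset.mem_union_right _ (Finset.mem_sdiff.2 ⟨hf, hfB⟩))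
    linarith
  · rw [Finset.mem_sdiff] at he
    obtain ⟨f, hf, hfB, hb⟩ := exists_swap_isBase hB hBs.indep (Finset.mem_coe.2 he.1) he.2
    refine ⟨e, he.2, f, mem_exchangeable.2 ⟨hf, hb⟩, ?_⟩
    have h2 := hemax f (Finset.mem_union_left _ (Finset.mem_sdiff.2 ⟨hf, hfB⟩))
    refine lt_of_le_of_ne h2 fun h => he.2 (hw h ▸ hf)

end Exchange

/-! ### The greedy algorithm and the neighbourhood computation -/

section Subroutines

variable {α : Type*} [DecidableEq α] {M : Matroid α} {w : α → ℝ}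

open Classical in
/-- One step of the greedy algorithm. -/
noncomputable def greedyStep (M : Matroid α) (B : Finset α) (e : α) : Finset α :=
  if M.Indep (insert e B : Finset α) then insert e B else B

lemma greedyLoop_eq (l : List α) : greedyLoop M l = l.foldl (greedyStep M) ∅ := rfl

lemma subset_greedyStep (B : Finset α) (e : α) : B ⊆ greedyStep M B e := by
  unfold greedyStep
  split_ifs
  · exact Finset.subset_insert _ _
  · exact subset_rfl

lemma subset_foldl_greedyStep (l : List α) (B : Finset α) : B ⊆ l.foldl (greedyStep M) B := by
  induction l generalizing B with
  | nil => exact subset_rfl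
  | cons a l ih => exact (subset_greedyStep B a).trans (ih _)

lemma foldl_greedyStep_subset (l : List α) (B : Finset α) :
    l.foldl (greedyStep M) B ⊆ B ∪ l.toFinset := by
  induction l generalizing B with
  | nil => simp
  | cons a l ih =>
    refine (ih _).trans ?_
    intro y
    simp only [greedyStep, List.toFinset_cons, Finset.mem_union, Finset.mem_insert]
    split_ifs
    · simp only [Finset.mem_insert]; tauto
    · tauto

lemma indep_foldl_greedyStep (l : List α) (B : Finset α) (hB : M.Indep (B : Set α)) :
    M.Indep (↑(l.foldl (greedyStep M) B) : Set α) := by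
  induction l generalizing B with
  | nil => exact hB
  | cons a l ih =>
    refine ih _ ?_
    unfold greedyStep
    split_ifs with h
    · exact h
    · exact hB

/-- An element is rejected by the greedy loop only if it is dependent on elements that precede it
in the enumeration. -/
lemma exists_not_indep_insert_of_notMem_greedyLoop {l : List α}
    (hl : l.Pairwise (fun a b => w b ≤ w a)) {e : α} (hel : e ∈ l) (he : e ∉ greedyLoop M l) :
    ∃ J ⊆ greedyLoop M l, (∀ y ∈ J, w e ≤ w y) ∧ ¬ M.Indep (insert e J : Finset α) := by
  obtain ⟨l₁, l₂, rfl⟩ := List.append_of_mem hel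
  have hsplit : greedyLoop M (l₁ ++ e :: l₂) =
      l₂.foldl (greedyStep M) (greedyStep M (l₁.foldl (greedyStep M) ∅) e) := by
    rw [greedyLoop_eq, List.foldl_append, List.foldl_cons]
  have hsub := subset_foldl_greedyStep (M := M) l₂
    (greedyStep M (l₁.foldl (greedyStep M) ∅) e)
  rw [← hsplit] at hsub
  refine ⟨l₁.foldl (greedyStep M) ∅, (subset_greedyStep _ _).trans hsub, ?_, ?_⟩
  · intro y hy
    have hy' := foldl_greedyStep_subset (M := M) l₁ ∅ hy
    simp only [Finset.empty_union, List.mem_toFinset] at hy'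
    exact (List.pairwise_append.1 hl).2.2 y hy' e List.mem_cons_self
  · intro h
    apply he
    apply hsub
    rw [greedyStep, if_pos h]
    exact Finset.mem_insert_self _ _

lemma IsGreedyOutput.isBase {B : Finset α} (h : IsGreedyOutput M w B) :
    M.IsBase (B : Set α) := by
  obtain ⟨l, -, hmem, hpair, rfl⟩ := h
  refine Matroid.Indep.isBase_of_forall_insert
    (indep_foldl_greedyStep l ∅ (by simp)) fun e he hins => ?_
  obtain ⟨J, hJ, -, hdep⟩ :=
    exists_not_indep_insert_of_notMem_greedyLoop (M := M) hpair (hmem e)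
      (by exact_mod_cast he.2)
  refine hdep (hins.subset ?_)
  rw [Finset.coe_insert]
  exact Set.insert_subset_insert (Finset.coe_subset.2 hJ)

/-- No swap strictly improves the output of the greedy algorithm. -/
lemma IsGreedyOutput.le_of_mem_exchangeable {B : Finset α} (h : IsGreedyOutput M w B) {x e : α}
    (he : e ∉ B) (hx : x ∈ exchangeable M B e) : w e ≤ w x := by
  obtain ⟨l, -, hmem, hpair, rfl⟩ := h
  rw [mem_exchangeable] at hx
  by_contra! hlt
  obtain ⟨J, hJ, hJw, hdep⟩ :=
    exists_not_indep_insert_of_notMem_greedyLoop (M := M) hpair (hmem e) he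
  refine hdep (hx.2.indep.subset (Finset.coe_subset.2 ?_))
  refine Finset.insert_subset_insert e fun y hy => Finset.mem_erase.2 ⟨?_, hJ hy⟩
  rintro rfl
  exact absurd (hJw y hy) (not_le.2 hlt)

variable [Fintype α]

/-- The neighbourhood consists of one swap for each `e ∉ B`: the first one, in the order of `q`,
that yields a base. -/
lemma mem_computeNeighbors {B B' : Finset α} {q : List α} :
    B' ∈ computeNeighbors M B q ↔ ∃ e, e ∉ B ∧ ∃ q₁ x q₂, q = q₁ ++ x :: q₂ ∧
      M.IsBase (swap B x e : Set α) ∧ (∀ y ∈ q₁, ¬ M.IsBase (swap B y e : Set α)) ∧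
      B' = swap B x e := by
  classical
  suffices H : ∀ (q : List α) (S : Finset (Finset α) × Finset α),
      B' ∈ (q.foldl (fun (S : Finset (Finset α) × Finset α) x =>
        (S.1 ∪ (S.2.filter fun e => M.IsBase (swap B x e : Set α)).image (swap B x),
         S.2.filter fun e => ¬ M.IsBase (swap B x e : Set α))) S).1 ↔
      B' ∈ S.1 ∨ ∃ e ∈ S.2, ∃ q₁ x q₂, q = q₁ ++ x :: q₂ ∧
        M.IsBase (swap B x e : Set α) ∧ (∀ y ∈ q₁, ¬ M.IsBase (swap B y e : Set α)) ∧
        B' = swap B x e by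
    have := H q (∅, Finset.univ \ B)
    simp only [Finset.notMem_empty, false_or, Finset.mem_sdiff, Finset.mem_univ, true_and] at this
    unfold computeNeighbors
    convert this
  intro q
  induction q with
  | nil => intro S; simp
  | cons a q ih =>
    intro S
    rw [List.foldl_cons, ih]
    simp only [Finset.mem_union, Finset.mem_image, Finset.mem_filter]
    constructor
    · rintro ((h | ⟨e, ⟨heS, hb⟩, rfl⟩) | ⟨e, ⟨heS, hnb⟩, q₁, x, q₂, rfl, hb, hq, rfl⟩)
      · exact Or.inl h
      · exact Or.inr ⟨e, heS, [], a, q, rfl, hb, by simp, rfl⟩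
      · refine Or.inr ⟨e, heS, a :: q₁, x, q₂, rfl, hb, ?_, rfl⟩
        intro y hy
        rcases List.mem_cons.1 hy with rfl | hy
        · exact hnb
        · exact hq y hy
    · rintro (h | ⟨e, heS, q₁, x, q₂, hq, hb, hqb, rfl⟩)
      · exact Or.inl (Or.inl h)
      · cases q₁ with
        | nil =>
          simp only [List.nil_append, List.cons.injEq] at hq
          obtain ⟨rfl, rfl⟩ := hq
          exact Or.inl (Or.inr ⟨e, ⟨heS, hb⟩, rfl⟩)
        | cons b q₁ =>
          simp only [List.cons_append, List.cons.injEq] at hq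
          obtain ⟨rfl, rfl⟩ := hq
          exact Or.inr ⟨e, ⟨heS, hqb a List.mem_cons_self⟩, q₁, x, q₂, rfl, hb,
            fun y hy => hqb y (List.mem_cons_of_mem _ hy), rfl⟩

/-- For distinct values, the neighbourhood computed along the increasing order is
`{B - σ(e) + e : e ∉ B}`. -/
lemma computeNeighbors_eq_image {B : Finset α} {q : List α} (hE : M.E = Set.univ)
    (hM : M.Loopless) (hB : M.IsBase (B : Set α)) (hw : Function.Injective w)
    (hq : IsIncreasingOrder w B q) :
    computeNeighbors M B q =
      (Finset.univ \ B).image fun e => swap B (sigma M B w e) e := by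
  obtain ⟨-, hqB, hsort⟩ := hq
  have hmemq : ∀ y, y ∈ q ↔ y ∈ B := fun y => by rw [← hqB, List.mem_toFinset]
  have key : ∀ e, e ∉ B → ∀ q₁ x q₂, q = q₁ ++ x :: q₂ → M.IsBase (swap B x e : Set α) →
      (∀ y ∈ q₁, ¬ M.IsBase (swap B y e : Set α)) → x = sigma M B w e := by
    intro e he q₁ x q₂ hq hb hfirst
    have hxB : x ∈ B := (hmemq x).1 (by simp [hq])
    have hs := sigma_mem (w := w) (exchangeable_nonempty hE hM hB he)
    rw [mem_exchangeable] at hs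
    refine hw (le_antisymm ?_ (sigma_le (mem_exchangeable.2 ⟨hxB, hb⟩)))
    have hsq := (hmemq _).2 hs.1
    rw [hq, List.mem_append, List.mem_cons] at hsq
    rcases hsq with h | h | h
    · exact absurd hs.2 (hfirst _ h)
    · rw [h]
    · rw [hq] at hsort
      exact List.rel_of_pairwise_cons (List.pairwise_append.1 hsort).2.1 h
  ext B'
  rw [mem_computeNeighbors]
  simp only [Finset.mem_image, Finset.mem_sdiff, Finset.mem_univ, true_and]
  constructor
  · rintro ⟨e, he, q₁, x, q₂, hq, hb, hfirst, rfl⟩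
    exact ⟨e, he, by rw [← key e he q₁ x q₂ hq hb hfirst]⟩
  · rintro ⟨e, he, rfl⟩
    classical
    obtain ⟨x, hx⟩ := exchangeable_nonempty hE hM hB he
    rw [mem_exchangeable] at hx
    have hsome : (q.find? fun y => decide (M.IsBase (swap B y e : Set α))).isSome := by
      rw [List.find?_isSome]
      exact ⟨x, (hmemq x).2 hx.1, by simpa using hx.2⟩
    obtain ⟨y, hy⟩ := Option.isSome_iff_exists.1 hsome
    obtain ⟨hyb, q₁, q₂, hq, hfirst⟩ := List.find?_eq_some_iff_append.1 hy
    have hyb' : M.IsBase (swap B y e : Set α) := by simpa using hyb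
    have hfirst' : ∀ z ∈ q₁, ¬ M.IsBase (swap B z e : Set α) := by simpa using hfirst
    exact ⟨e, he, q₁, y, q₂, hq, hyb', hfirst', by rw [key e he q₁ y q₂ hq hyb' hfirst']⟩

end Subroutines

/-! ### Counting rounds -/

section Counting

/-- The rounds at which a counter increases to a value of at most `h` number at most `h`. -/
lemma card_filter_count_le (A : ℕ → Prop) [DecidablePred A] {h : ℝ} (hh : 0 ≤ h) (T : ℕ) :
    (((Finset.Icc 1 T).filter fun s =>
      A s ∧ ((((Finset.Icc 1 s).filter A).card : ℕ) : ℝ) ≤ h).card : ℝ) ≤ h := by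
  suffices H : (((Finset.Icc 1 T).filter fun s =>
      A s ∧ ((((Finset.Icc 1 s).filter A).card : ℕ) : ℝ) ≤ h).card : ℝ) ≤ h ∧
      ((Finset.Icc 1 T).filter fun s =>
      A s ∧ ((((Finset.Icc 1 s).filter A).card : ℕ) : ℝ) ≤ h).card ≤
        ((Finset.Icc 1 T).filter A).card from H.1
  refine ⟨?_, Finset.card_le_card (Finset.monotone_filter_right _ fun s _ hs => hs.1)⟩
  induction T with
  | zero => simpa using hh
  | succ T ih =>
    rw [← Finset.insert_Icc_right_eq_Icc_add_one (by omega), Finset.filter_insert]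
    split_ifs with hT
    · refine le_trans ?_ hT.2
      rw [Nat.cast_le]
      rw [← Finset.insert_Icc_right_eq_Icc_add_one (by omega), Finset.filter_insert, if_pos hT.1]
      refine Finset.card_le_card (Finset.insert_subset_insert _ ?_)
      exact Finset.monotone_filter_right _ fun s _ hs => hs.1
    · exact ih

variable {α : Type*} [DecidableEq α] {P L : ℕ → Finset α} {B : Finset α} {e : α} {t : ℕ}

lemma plays_zero : plays P e 0 = 1 := by simp [plays]

lemma plays_succ_of_mem (h : e ∈ P (t + 1)) : plays P e (t + 1) = plays P e t + 1 := by
  rw [plays, plays, ← Finset.insert_Icc_right_eq_Icc_add_one (by omega), Finset.filter_insert,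
    if_pos h, Finset.card_insert_of_notMem (by simp)]
  ring

lemma plays_succ_of_notMem (h : e ∉ P (t + 1)) : plays P e (t + 1) = plays P e t := by
  rw [plays, plays, ← Finset.insert_Icc_right_eq_Icc_add_one (by omega), Finset.filter_insert,
    if_neg h]

lemma plays_le_succ : plays P e t ≤ plays P e (t + 1) := by
  by_cases h : e ∈ P (t + 1)
  · rw [plays_succ_of_mem h]; omega
  · rw [plays_succ_of_notMem h]

lemma plays_pos : 0 < plays P e t := by rw [plays]; omega

lemma leaderTime_zero : leaderTime L B 0 = 0 := by simp [leaderTime]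

lemma leaderTime_succ_of_eq (h : L (t + 1) = B) :
    leaderTime L B (t + 1) = leaderTime L B t + 1 := by
  rw [leaderTime, leaderTime, ← Finset.insert_Icc_right_eq_Icc_add_one (by omega),
    Finset.filter_insert, if_pos h, Finset.card_insert_of_notMem (by simp)]

lemma leaderTime_succ_of_ne (h : L (t + 1) ≠ B) :
    leaderTime L B (t + 1) = leaderTime L B t := by
  rw [leaderTime, leaderTime, ← Finset.insert_Icc_right_eq_Icc_add_one (by omega),
    Finset.filter_insert, if_neg h]

lemma leaderTime_mono (L : ℕ → Finset α) (B : Finset α) : Monotone (leaderTime L B) := fun _ _ h =>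
  Finset.card_le_card (Finset.filter_subset_filter _ (Finset.Icc_subset_Icc_right h))

lemma leaderTime_le (L : ℕ → Finset α) (B : Finset α) (t : ℕ) : leaderTime L B t ≤ t := by
  simpa [leaderTime] using Finset.card_filter_le (Finset.Icc 1 t) (fun s => L s = B)

/-- An element is played at most `h` times while its play count is at most `h`. -/
lemma card_filter_plays_le (P : ℕ → Finset α) (e : α) {h : ℝ} (hh : 0 ≤ h) (T : ℕ) :
    (((Finset.Icc 1 T).filter fun s => e ∈ P s ∧ (plays P e (s - 1) : ℝ) ≤ h).card : ℝ) ≤ h := by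
  refine le_trans (le_of_eq ?_) (card_filter_count_le (fun s => e ∈ P s) hh T)
  congr 2
  refine Finset.filter_congr fun s hs => and_congr_right fun hes => ?_
  obtain ⟨t, rfl⟩ : ∃ t, s = t + 1 := ⟨s - 1, by have := (Finset.mem_Icc.1 hs).1; omega⟩
  have h1 := plays_succ_of_mem hes
  have h2 : plays P e t = ((Finset.Icc 1 (t + 1)).filter fun s => e ∈ P s).card := by
    rw [plays] at h1; omega
  rw [Nat.add_sub_cancel, h2]

/-- The rounds at which a base is played because it leads are, up to rounding, one in `k` of its
leaderships. -/
lemma mul_card_filter_dvd_le (L : ℕ → Finset α) (B : Finset α) (k T : ℕ) (hk : 0 < k) :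
    k * ((Finset.Icc 1 T).filter fun s => L s = B ∧ k ∣ leaderTime L B s - 1).card ≤
      leaderTime L B T + k := by
  -- the induction needs the rounding-up form, with `k - 1` in place of `k`
  suffices H : k * ((Finset.Icc 1 T).filter fun s => L s = B ∧ k ∣ leaderTime L B s - 1).card + 1 ≤
      leaderTime L B T + k by omega
  induction T with
  | zero => simp [leaderTime_zero]; omega
  | succ T ih =>
    rw [← Finset.insert_Icc_right_eq_Icc_add_one (by omega), Finset.filter_insert]
    have hmono := leaderTime_mono L B (Nat.le_succ T)
    split_ifs with hT
    · rw [Finset.card_insert_of_notMem (by simp)]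
      rw [leaderTime_succ_of_eq hT.1, Nat.add_sub_cancel] at hT
      rw [leaderTime_succ_of_eq hT.1]
      obtain ⟨m, hm⟩ := hT.2
      rw [hm] at ih ⊢
      have : ((Finset.Icc 1 T).filter fun s => L s = B ∧ k ∣ leaderTime L B s - 1).card < m + 1 := by
        refine Nat.lt_of_mul_lt_mul_left (a := k) ?_
        rw [mul_add]
        omega
      have := Nat.mul_le_mul_left k (Nat.lt_succ_iff.1 this)
      rw [mul_add]
      omega
    · exact ih.trans (by simpa using hmono)

end Counting

/-! ### Invariants of an execution -/

section Execution

lemma IsIncreasingOrder.congr {α : Type*} [DecidableEq α] {w w' : α → ℝ} {B : Finset α} {l : List α}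
    (h : IsIncreasingOrder w B l) (hw : ∀ a ∈ B, ∀ b ∈ B, w a ≤ w b → w' a ≤ w' b) :
    IsIncreasingOrder w' B l := by
  obtain ⟨h1, h2, h3⟩ := h
  refine ⟨h1, h2, h3.imp_of_mem fun ha hb hab => ?_⟩
  exact hw _ (by rw [← h2]; simpa using ha) _ (by rw [← h2]; simpa using hb) hab

variable {α : Type*} [Fintype α] [DecidableEq α] {M : Matroid α} {x : α → ℕ → ℝ}
  {L : ℕ → Finset α} {q : ℕ → List α} {N : ℕ → Finset (Finset α)} {P : ℕ → Finset α}

/-- Either the leader has just been computed by the greedy algorithm, or it is the previous leader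
and no member of the previous neighbourhood improves on it. -/
lemma IsExecution.greedy_or_kept (h : IsExecution M x L q N P) (t : ℕ) :
    IsGreedyOutput M (empMean x P t) (L (t + 1)) ∨
      L (t + 1) = L t ∧ ∀ B ∈ N t, value (empMean x P t) B ≤ value (empMean x P t) (L t) := by
  by_cases hc : ∃ B ∈ N t, value (empMean x P t) (L t) < value (empMean x P t) B
  · exact Or.inl (h.new_leader t hc).1
  · refine Or.inr ⟨h.same_leader t hc, fun B hB => ?_⟩
    by_contra! hlt
    exact hc ⟨B, hB, hlt⟩

lemma IsExecution.isBase_leader (h : IsExecution M x L q N P) (t : ℕ) :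
    M.IsBase (L t : Set α) := by
  induction t with
  | zero => exact h.init_leader.isBase
  | succ t ih =>
    rcases h.greedy_or_kept t with hg | ⟨hk, -⟩
    · exact hg.isBase
    · rwa [hk]

lemma IsExecution.order_succ_of (h : IsExecution M x L q N P) {t : ℕ}
    (hq : ∃ w, IsIncreasingOrder w (L t) (q t)) (hN : N t = computeNeighbors M (L t) (q t)) :
    IsIncreasingOrder (empMean x P t) (L (t + 1)) (q (t + 1)) ∧
      N (t + 1) = computeNeighbors M (L (t + 1)) (q (t + 1)) := by
  by_cases hc : ∃ B ∈ N t, value (empMean x P t) (L t) < value (empMean x P t) B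
  · exact (h.new_leader t hc).2
  · by_cases hs : (q t).Pairwise (fun a b => empMean x P t a ≤ empMean x P t b)
    · obtain ⟨w, hw⟩ := hq
      obtain ⟨h1, h2⟩ := h.same_nbrs t hc hs
      rw [h.same_leader t hc, h1, h2]
      exact ⟨⟨hw.1, hw.2.1, hs⟩, hN⟩
    · exact h.new_nbrs t hc hs

/-- The neighbourhood always belongs to the current leader and to an order of its elements that is
increasing for the latest estimates. -/
lemma IsExecution.order_succ (h : IsExecution M x L q N P) (t : ℕ) :
    IsIncreasingOrder (empMean x P t) (L (t + 1)) (q (t + 1)) ∧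
      N (t + 1) = computeNeighbors M (L (t + 1)) (q (t + 1)) := by
  induction t with
  | zero => exact h.order_succ_of ⟨_, h.init_order⟩ h.init_nbrs
  | succ t ih => exact h.order_succ_of ⟨_, ih.1⟩ ih.2

lemma IsExecution.isBase_played (h : IsExecution M x L q N P) (t : ℕ) :
    M.IsBase (P (t + 1) : Set α) := by
  by_cases hd : (Fintype.card α - rank M + 1) ∣ (leaderTime L (L (t + 1)) (t + 1) - 1)
  · rw [h.play_leader t hd]
    exact h.isBase_leader _
  · rcases Finset.mem_insert.1 (h.play_optimistic t hd).1 with hP | hP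
    · rw [hP]
      exact h.isBase_leader _
    · rw [(h.order_succ t).2, mem_computeNeighbors] at hP
      obtain ⟨e, -, q₁, y, q₂, -, hb, -, hP⟩ := hP
      rwa [hP]

/-- Forced play of the leader: each of its elements is sampled in proportion to the number of
leaderships. -/
lemma IsExecution.leaderTime_add_le (h : IsExecution M x L q N P) {B : Finset α} {b : α}
    (hb : b ∈ B) (t : ℕ) :
    leaderTime L B t + (Fintype.card α - rank M + 1) ≤
      (Fintype.card α - rank M + 1) * plays P b t := by
  induction t with
  | zero => simp [leaderTime_zero, plays_zero]
  | succ t ih =>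
    have hplay : plays P b t ≤ plays P b (t + 1) := plays_le_succ
    have hmul := Nat.mul_le_mul_left (Fintype.card α - rank M + 1) hplay
    by_cases hL : L (t + 1) = B
    · have hl := leaderTime_succ_of_eq hL
      by_cases hd : (Fintype.card α - rank M + 1) ∣ (leaderTime L (L (t + 1)) (t + 1) - 1)
      · have hbP : b ∈ P (t + 1) := by rw [h.play_leader t hd, hL]; exact hb
        rw [hl, plays_succ_of_mem hbP, mul_add]
        omega
      · rw [hL, hl, Nat.add_sub_cancel] at hd
        have hne : leaderTime L B t + (Fintype.card α - rank M + 1) ≠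
            (Fintype.card α - rank M + 1) * plays P b t := by
          intro heq
          exact hd ((Nat.dvd_add_left (dvd_refl _)).1 (heq ▸ dvd_mul_right _ _))
        omega
    · rw [leaderTime_succ_of_ne hL]
      omega

end Execution

/-! ### Regret along a typical path -/

section Index

variable {α : Type*} {μ : α → ℝ} {ε : ℝ}

/-- All differences of the entries of `μ` are at least `4 ε`. -/
def IsSeparated (μ : α → ℝ) (ε : ℝ) : Prop := ∀ a b, μ a < μ b → μ a + 4 * ε ≤ μ b

lemma exists_isSeparated [Fintype α] (μ : α → ℝ) : ∃ ε, 0 < ε ∧ IsSeparated μ ε := by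
  classical
  let S : Finset ℝ := insert 1
    (((Finset.univ : Finset (α × α)).filter fun p => μ p.1 < μ p.2).image fun p => μ p.2 - μ p.1)
  have hS : S.Nonempty := ⟨1, Finset.mem_insert_self _ _⟩
  refine ⟨S.min' hS / 4, ?_, fun a b hab => ?_⟩
  · have hpos : 0 < S.min' hS := by
      rw [Finset.lt_min'_iff]
      intro y hy
      rcases Finset.mem_insert.1 hy with rfl | hy
      · exact one_pos
      · obtain ⟨p, hp, rfl⟩ := Finset.mem_image.1 hy
        exact sub_pos.2 (Finset.mem_filter.1 hp).2
    linarith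
  · have := S.min'_le (μ b - μ a) (Finset.mem_insert_of_mem
      (Finset.mem_image.2 ⟨(a, b), by simpa using hab, rfl⟩))
    linarith

lemma le_of_estimate_le (hε : IsSeparated μ ε) {w : α → ℝ} {a b : α} (ha : |w a - μ a| < ε)
    (hb : |w b - μ b| < ε) (hab : w a ≤ w b) : μ a ≤ μ b := by
  by_contra! hlt
  have := hε b a hlt
  rw [abs_lt] at ha hb
  linarith [abs_nonneg (w a - μ a)]

/-- Width of the confidence bonus: `n` samples make it smaller than `c` as soon as
`2 log s / c ^ 2 < n`. -/
lemma le_of_le_sqrt_log {s n : ℕ} {c : ℝ} (hc : 0 < c) (hn : 0 < n)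
    (h : c ≤ Real.sqrt (2 * Real.log s / n)) : (n : ℝ) ≤ 2 * Real.log s / c ^ 2 := by
  have h1 := Real.log_natCast_nonneg s
  have hn' : (0 : ℝ) < n := by exact_mod_cast hn
  have h2 := (Real.le_sqrt hc.le (by positivity)).1 h
  rw [le_div_iff₀ hn'] at h2
  rw [le_div_iff₀ (by positivity)]
  linarith

variable [DecidableEq α] {x : α → ℕ → ℝ} {L P : ℕ → Finset α}

/-- After more than `V` samples the empirical mean of each element is `ε`-accurate, and for `s > V`
no upper confidence index with bonus based on `log s` fails while there are at most `s` samples. -/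
structure IsTypicalPath (μ : α → ℝ) (ε V : ℝ) (x : α → ℕ → ℝ) (P : ℕ → Finset α) : Prop where
  concentrated : ∀ e t, V < plays P e t → |empMean x P t e - μ e| < ε
  optimistic : ∀ e t (s : ℕ), V < s → plays P e t ≤ s →
    μ e ≤ empMean x P t e + Real.sqrt (2 * Real.log s / plays P e t)

/-- The upper confidence index of an element in round `t + 1`. -/
noncomputable def index (x : α → ℕ → ℝ) (L P : ℕ → Finset α) (t : ℕ) (e : α) : ℝ :=
  empMean x P t e +
    Real.sqrt (2 * Real.log (leaderTime L (L (t + 1)) (t + 1)) / plays P e t)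

lemma optimisticValue_eq (t : ℕ) (B : Finset α) :
    optimisticValue x L P t B = value (index x L P t) B := rfl

lemma empMean_le_index (t : ℕ) (e : α) : empMean x P t e ≤ index x L P t e :=
  le_add_of_nonneg_right (Real.sqrt_nonneg _)

end Index

section TypicalPath

variable {α : Type*} [Fintype α] [DecidableEq α] {M : Matroid α} {x : α → ℕ → ℝ}
  {L : ℕ → Finset α} {q : ℕ → List α} {N : ℕ → Finset (Finset α)} {P : ℕ → Finset α}
  {μ : α → ℝ} {ε V : ℝ} {Bs : Finset α}

/-- The elements of a base that has led often enough are estimated accurately. -/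
lemma IsTypicalPath.abs_sub_lt_of_leaderTime (hV : IsTypicalPath μ ε V x P)
    (h : IsExecution M x L q N P) {B : Finset α} {b : α} {t : ℕ} (hb : b ∈ B)
    (ht : ((Fintype.card α - rank M + 1 : ℕ) : ℝ) * V < leaderTime L B t + 1) :
    |empMean x P t b - μ b| < ε := by
  refine hV.concentrated b t ?_
  have h1 := h.leaderTime_add_le hb t
  have h2 : (leaderTime L B t : ℝ) + ((Fintype.card α - rank M + 1 : ℕ) : ℝ) ≤
      ((Fintype.card α - rank M + 1 : ℕ) : ℝ) * plays P b t := by exact_mod_cast h1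
  have h3 : (1 : ℝ) ≤ ((Fintype.card α - rank M + 1 : ℕ) : ℝ) := by
    exact_mod_cast Nat.le_add_left _ _
  nlinarith

/-- Once a leader is estimated accurately, its neighbourhood is the one computed from the true
means. -/
lemma IsTypicalPath.nbrs_eq (hV : IsTypicalPath μ ε V x P) (h : IsExecution M x L q N P)
    (hE : M.E = Set.univ) (hM : M.Loopless) (hμ : Function.Injective μ) (hε : IsSeparated μ ε)
    {t : ℕ} (ht : ((Fintype.card α - rank M + 1 : ℕ) : ℝ) * V < leaderTime L (L (t + 1)) t + 1) :
    N (t + 1) = (Finset.univ \ L (t + 1)).image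
      fun e => swap (L (t + 1)) (sigma M (L (t + 1)) μ e) e := by
  obtain ⟨h1, h2⟩ := h.order_succ t
  rw [h2]
  refine computeNeighbors_eq_image hE hM (h.isBase_leader _) hμ (h1.congr fun a ha b hb hab => ?_)
  exact le_of_estimate_le hε (hV.abs_sub_lt_of_leaderTime h ha ht)
    (hV.abs_sub_lt_of_leaderTime h hb ht) hab

/-- Shape of the base played in a round with an accurately estimated leader. -/
lemma IsTypicalPath.played_eq (hV : IsTypicalPath μ ε V x P) (h : IsExecution M x L q N P)
    (hE : M.E = Set.univ) (hM : M.Loopless) (hμ : Function.Injective μ) (hε : IsSeparated μ ε)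
    {t : ℕ} (ht : ((Fintype.card α - rank M + 1 : ℕ) : ℝ) * V < leaderTime L (L (t + 1)) t + 1) :
    P (t + 1) = L (t + 1) ∨ ∃ e, e ∉ L (t + 1) ∧
      P (t + 1) = swap (L (t + 1)) (sigma M (L (t + 1)) μ e) e ∧
      index x L P t (sigma M (L (t + 1)) μ e) ≤ index x L P t e := by
  by_cases hd : (Fintype.card α - rank M + 1) ∣ (leaderTime L (L (t + 1)) (t + 1) - 1)
  · exact Or.inl (h.play_leader t hd)
  obtain ⟨hP, hmax⟩ := h.play_optimistic t hd
  rcases Finset.mem_insert.1 hP with hP | hP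
  · exact Or.inl hP
  rw [hV.nbrs_eq h hE hM hμ hε ht] at hP
  obtain ⟨e, he, hP⟩ := Finset.mem_image.1 hP
  have he' : e ∉ L (t + 1) := (Finset.mem_sdiff.1 he).2
  refine Or.inr ⟨e, he', hP.symm, ?_⟩
  have hs := mem_exchangeable.1
    (sigma_mem (w := μ) (exchangeable_nonempty hE hM (h.isBase_leader (t + 1)) he'))
  have h1 := hmax _ (Finset.mem_insert_self _ _)
  rw [← hP, optimisticValue_eq, optimisticValue_eq, value_swap _ hs.1 he'] at h1
  linarith

/-- When the leader is accurately estimated and its gaps are positive, a swap is played only if the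
incoming element has few samples: if it is accurately estimated as well, then its confidence bonus
is at least half its gap. -/
lemma IsTypicalPath.optimal_round (hV : IsTypicalPath μ ε V x P) (h : IsExecution M x L q N P)
    (hE : M.E = Set.univ) (hM : M.Loopless) (hμ : Function.Injective μ) (hε : IsSeparated μ ε)
    {t : ℕ} (ht : ((Fintype.card α - rank M + 1 : ℕ) : ℝ) * V < leaderTime L (L (t + 1)) t + 1)
    (hgap : ∀ e, e ∉ L (t + 1) → 0 < gap M (L (t + 1)) μ e) :
    P (t + 1) = L (t + 1) ∨ ∃ e, e ∉ L (t + 1) ∧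
      P (t + 1) = swap (L (t + 1)) (sigma M (L (t + 1)) μ e) e ∧
      ((plays P e t : ℝ) ≤ V ∨ (plays P e t : ℝ) ≤
        8 * Real.log (leaderTime L (L (t + 1)) (t + 1)) / gap M (L (t + 1)) μ e ^ 2) := by
  rcases hV.played_eq h hE hM hμ hε ht with hP | ⟨e, he, hP, hi⟩
  · exact Or.inl hP
  refine Or.inr ⟨e, he, hP, ?_⟩
  by_cases hpl : (plays P e t : ℝ) ≤ V
  · exact Or.inl hpl
  refine Or.inr ?_
  have hs := mem_exchangeable.1
    (sigma_mem (w := μ) (exchangeable_nonempty hE hM (h.isBase_leader (t + 1)) he))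
  have h1 := abs_lt.1 (hV.concentrated e t (not_le.1 hpl))
  have h2 := abs_lt.1 (hV.abs_sub_lt_of_leaderTime h hs.1 ht)
  have h3 := empMean_le_index (x := x) (L := L) (P := P) t (sigma M (L (t + 1)) μ e)
  have hg := hgap e he
  have h4 := hε e (sigma M (L (t + 1)) μ e) (sub_pos.1 hg)
  have h5 : gap M (L (t + 1)) μ e / 2 ≤
      Real.sqrt (2 * Real.log (leaderTime L (L (t + 1)) (t + 1)) / plays P e t) := by
    have h6 : index x L P t e = empMean x P t e +
      Real.sqrt (2 * Real.log (leaderTime L (L (t + 1)) (t + 1)) / plays P e t) := rfl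
    rw [gap]
    linarith
  refine (le_of_le_sqrt_log (by linarith) plays_pos h5).trans (le_of_eq ?_)
  field_simp
  ring

/-- A suboptimal leader survives only while the elements that improve on it are underestimated.
Then their indices force the played swap to bring in an element with few samples. -/
lemma IsTypicalPath.suboptimal_round (hV : IsTypicalPath μ ε V x P) (hV0 : 0 ≤ V)
    (h : IsExecution M x L q N P) (hE : M.E = Set.univ) (hM : M.Loopless)
    (hμ : Function.Injective μ) (hε0 : 0 < ε) (hε : IsSeparated μ ε) {s₀ : ℕ}
    (hs₀ : ∀ s : ℕ, s₀ ≤ s →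
      2 * ((Fintype.card α - rank M + 1 : ℕ) : ℝ) * Real.log s ≤ ε ^ 2 * s)
    {t : ℕ} (ht : (s₀ : ℝ) + ((Fintype.card α - rank M + 1 : ℕ) : ℝ) * V + 2 ≤
      leaderTime L (L (t + 1)) (t + 1))
    (himp : ∃ e, e ∉ L (t + 1) ∧ ∃ y ∈ exchangeable M (L (t + 1)) e, μ y < μ e) :
    (Fintype.card α - rank M + 1) ∣ (leaderTime L (L (t + 1)) (t + 1) - 1) ∨
      ∃ f, f ∉ L (t + 1) ∧ f ∈ P (t + 1) ∧ (plays P f t : ℝ) ≤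
        V + Real.log (leaderTime L (L (t + 1)) (t + 1)) / (8 * ε ^ 2) := by
  set k := Fintype.card α - rank M + 1 with hk
  have hk1 : (1 : ℝ) ≤ (k : ℝ) := by exact_mod_cast Nat.le_add_left _ _
  obtain ⟨B, hB⟩ : ∃ B, L (t + 1) = B := ⟨_, rfl⟩
  obtain ⟨s, hs⟩ : ∃ s, leaderTime L B (t + 1) = s := ⟨_, rfl⟩
  have hst : s = leaderTime L B t + 1 := by rw [← hs, leaderTime_succ_of_eq hB]
  have hstR : (s : ℝ) = leaderTime L B t + 1 := by exact_mod_cast hst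
  rw [hB, hs] at ht
  have hs₀' : (0 : ℝ) ≤ s₀ := Nat.cast_nonneg _
  have hVs : V < s := by nlinarith
  have hconc : (k : ℝ) * V < leaderTime L (L (t + 1)) t + 1 := by rw [hB]; linarith
  obtain ⟨e, heB, y, hy, hye⟩ := himp
  rw [hB] at heB hy
  have hbase : M.IsBase (B : Set α) := hB ▸ h.isBase_leader (t + 1)
  have hacc : ∀ b ∈ B, -ε < empMean x P t b - μ b ∧ empMean x P t b - μ b < ε := fun b hb =>
    abs_lt.1 (hV.abs_sub_lt_of_leaderTime h hb (hB ▸ hconc))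
  -- an improving element is underestimated, as otherwise the leader would have been replaced
  have hunder : ∀ f, f ∉ B → μ (sigma M B μ f) < μ f → (plays P f t : ℝ) ≤ V := by
    intro f hf hσ
    by_contra! hpl
    have h1 := abs_lt.1 (hV.concentrated f t hpl)
    have hσm := sigma_mem (w := μ) (exchangeable_nonempty hE hM hbase hf)
    have hσB := (mem_exchangeable.1 hσm).1
    have h2 := hacc _ hσB
    have h3 := hε _ _ hσ
    rcases h.greedy_or_kept t with hg | ⟨hkept, hno⟩
    · have := (hB ▸ hg).le_of_mem_exchangeable hf hσm
      linarith
    · -- the neighbourhood that was tested stems from the previous leadership; the summand `2` in the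
      -- threshold ensures that this leadership exists and was accurately estimated, too
      obtain ⟨u, rfl⟩ : ∃ u, t = u + 1 := by
        refine ⟨t - 1, ?_⟩
        have : t ≠ 0 := by
          rintro rfl
          rw [leaderTime_zero] at hstR
          push_cast at hstR
          nlinarith
        omega
      rw [hkept] at hB
      have hlt := leaderTime_succ_of_eq hB
      have hconc' : (k : ℝ) * V < leaderTime L (L (u + 1)) u + 1 := by
        rw [hB]
        have : (leaderTime L B (u + 1) : ℝ) = leaderTime L B u + 1 := by exact_mod_cast hlt
        linarith
      have hmem : swap B (sigma M B μ f) f ∈ N (u + 1) := by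
        rw [hV.nbrs_eq h hE hM hμ hε hconc', hB]
        exact Finset.mem_image.2 ⟨f, by simpa using hf, rfl⟩
      have := hno _ hmem
      rw [hB, value_swap _ hσB hf] at this
      linarith
  by_cases hd : k ∣ (leaderTime L (L (t + 1)) (t + 1) - 1)
  · exact Or.inl hd
  refine Or.inr ?_
  obtain ⟨hP, hmax⟩ := h.play_optimistic t hd
  have hN := hV.nbrs_eq h hE hM hμ hε hconc
  rw [hN, hB] at hP hmax
  have hlog := Real.log_natCast_nonneg s
  have hσm := sigma_mem (w := μ) (exchangeable_nonempty hE hM hbase heB)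
  have hσB := (mem_exchangeable.1 hσm).1
  have hσe : μ (sigma M B μ e) < μ e := (sigma_le hy).trans_lt hye
  have hpl := hunder e heB hσe
  have hopt : μ e ≤ index x L P t e := by
    rw [index, hB, hs]
    exact hV.optimistic e t s hVs (by exact_mod_cast hpl.trans hVs.le)
  -- forced plays of the leader have made the bonus of its elements small
  have hbonus : Real.sqrt (2 * Real.log s / plays P (sigma M B μ e) t) ≤ ε := by
    have h1 : (leaderTime L B t : ℝ) + k ≤ k * plays P (sigma M B μ e) t := by
      exact_mod_cast h.leaderTime_add_le hσB t
    have h2 := hs₀ s (by exact_mod_cast (by nlinarith : (s₀ : ℝ) ≤ s))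
    have hpos : (0 : ℝ) < plays P (sigma M B μ e) t := Nat.cast_pos.2 plays_pos
    refine Real.sqrt_le_iff.2 ⟨hε0.le, ?_⟩
    rw [div_le_iff₀ hpos]
    have h3 : (k : ℝ) * (2 * Real.log s) ≤ k * (ε ^ 2 * plays P (sigma M B μ e) t) := by
      have : (s : ℝ) ≤ k * plays P (sigma M B μ e) t := by linarith
      nlinarith [sq_nonneg ε]
    exact le_of_mul_le_mul_left h3 (by linarith)
  have hσi : index x L P t (sigma M B μ e) ≤ μ (sigma M B μ e) + 2 * ε := by
    have := hacc _ hσB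
    rw [index, hB, hs]
    linarith
  have hsep := hε _ _ hσe
  have hval : value (index x L P t) B + 2 * ε ≤ value (index x L P t) (P (t + 1)) := by
    have := hmax (swap B (sigma M B μ e) e)
      (Finset.mem_insert_of_mem (Finset.mem_image.2 ⟨e, by simpa using heB, rfl⟩))
    rw [optimisticValue_eq, optimisticValue_eq, value_swap _ hσB heB] at this
    linarith
  rcases Finset.mem_insert.1 hP with hP | hP
  · rw [hP] at hval
    linarith
  obtain ⟨f, hf, hP⟩ := Finset.mem_image.1 hP
  have hfB : f ∉ B := (Finset.mem_sdiff.1 hf).2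
  refine ⟨f, hB ▸ hfB, by rw [← hP]; exact Finset.mem_insert_self _ _, ?_⟩
  rw [hB, hs]
  have hlog' : 0 ≤ Real.log s / (8 * ε ^ 2) := by positivity
  by_cases hfV : (plays P f t : ℝ) ≤ V
  · linarith
  have hσfm := sigma_mem (w := μ) (exchangeable_nonempty hE hM hbase hfB)
  have hσfB := (mem_exchangeable.1 hσfm).1
  have hσf : μ f < μ (sigma M B μ f) := by
    refine lt_of_le_of_ne (le_of_not_gt fun hlt => hfV (hunder f hfB hlt)) fun heq => ?_
    exact hfB (by rw [hμ heq]; exact hσfB)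
  have h1 := abs_lt.1 (hV.concentrated f t (not_le.1 hfV))
  have h2 := hacc _ hσfB
  have h3 := hε _ _ hσf
  have h4 := empMean_le_index (x := x) (L := L) (P := P) t (sigma M B μ f)
  rw [← hP, value_swap _ hσfB hfB, index, index, hB, hs] at hval
  rw [index, hB, hs] at h4
  have h5 : 4 * ε ≤ Real.sqrt (2 * Real.log s / plays P f t) := by linarith
  have h6 := le_of_le_sqrt_log (by linarith) plays_pos h5
  have h7 : 2 * Real.log s / (4 * ε) ^ 2 = Real.log s / (8 * ε ^ 2) := by
    field_simp
    ring
  linarith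

end TypicalPath

/-! ### Value of the optimal base -/

section OptimalValue

variable {α : Type*} {M : Matroid α} {μ : α → ℝ} {Bs : Finset α}

lemma optValue_eq (hBs : M.IsBase (Bs : Set α))
    (hmax : ∀ I : Finset α, M.Indep (I : Set α) → I ≠ Bs → value μ I < value μ Bs) :
    optValue M μ = value μ Bs := by
  have hle : ∀ I : {I : Finset α // M.Indep (I : Set α)}, value μ I.1 ≤ value μ Bs := by
    rintro ⟨I, hI⟩
    rcases eq_or_ne I Bs with rfl | hne
    · exact le_rfl
    · exact (hmax I hI hne).le
  have : Nonempty {I : Finset α // M.Indep (I : Set α)} := ⟨⟨Bs, hBs.indep⟩⟩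
  refine le_antisymm (ciSup_le hle) ?_
  exact le_ciSup (f := fun I : {I : Finset α // M.Indep (I : Set α)} => value μ I.1)
    ⟨value μ Bs, by rintro _ ⟨I, rfl⟩; exact hle I⟩ ⟨Bs, hBs.indep⟩

lemma value_le_optValue [Fintype α] (μ : α → ℝ) {I : Finset α} (hI : M.Indep (I : Set α)) :
    value μ I ≤ optValue M μ :=
  le_ciSup (f := fun I : {I : Finset α // M.Indep (I : Set α)} => value μ I.1)
    (Set.finite_range _).bddAbove ⟨I, hI⟩

lemma gap_pos [DecidableEq α] (hE : M.E = Set.univ) (hM : M.Loopless) (hBs : M.IsBase (Bs : Set α))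
    (hmax : ∀ I : Finset α, M.Indep (I : Set α) → I ≠ Bs → value μ I < value μ Bs)
    {e : α} (he : e ∉ Bs) : 0 < gap M Bs μ e := by
  have hs := mem_exchangeable.1 (sigma_mem (w := μ) (exchangeable_nonempty hE hM hBs he))
  have := hmax _ hs.2.indep (swap_ne he)
  rw [value_swap μ hs.1 he] at this
  rw [gap]
  linarith

end OptimalValue

/-! ### Pathwise regret bound -/

section PathwiseRegret

lemma exists_forall_log_le {c ε : ℝ} (hc : 0 < c) (hε : 0 < ε) :
    ∃ s₀ : ℕ, ∀ s : ℕ, s₀ ≤ s → c * Real.log s ≤ ε * s := by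
  have h := (Real.isLittleO_log_id_atTop.comp_tendsto tendsto_natCast_atTop_atTop).bound
    (div_pos hε hc)
  obtain ⟨s₀, hs₀⟩ := eventually_atTop.1 h
  refine ⟨s₀, fun s hs => ?_⟩
  have h1 := hs₀ s hs
  simp only [Function.comp_apply, id, Real.norm_eq_abs, Nat.abs_cast] at h1
  have h2 := (le_abs_self _).trans h1
  rw [div_mul_eq_mul_div, le_div_iff₀ hc] at h2
  linarith

variable {α : Type*} [Fintype α] [DecidableEq α] {M : Matroid α} {x : α → ℕ → ℝ}
  {L : ℕ → Finset α} {q : ℕ → List α} {N : ℕ → Finset (Finset α)} {P : ℕ → Finset α}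
  {μ : α → ℝ} {ε V : ℝ} {B Bs : Finset α}

lemma card_sub_rank_add_one (hB : M.IsBase (B : Set α)) :
    Fintype.card α - rank M + 1 = (Finset.univ \ B).card + 1 := by
  rw [rank_eq_card hB, Finset.card_sdiff_of_subset (Finset.subset_univ _), Finset.card_univ]

/-- A suboptimal base leads at most proportionally to `1 + V` rounds: apart from the early and the
forced rounds, each of its leaderships plays an element with at most `V + O(log S)` samples, where
`S` is the number of leaderships. -/
lemma IsTypicalPath.leaderTime_le (hV : IsTypicalPath μ ε V x P) (hV0 : 0 ≤ V)
    (h : IsExecution M x L q N P) (hE : M.E = Set.univ) (hM : M.Loopless)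
    (hμ : Function.Injective μ) (hε0 : 0 < ε) (hε : IsSeparated μ ε) {s₀ : ℕ}
    (hs₀ : ∀ s : ℕ, s₀ ≤ s →
      2 * ((Fintype.card α - rank M + 1 : ℕ) : ℝ) * Real.log s ≤ ε ^ 2 * s)
    (hB : M.IsBase (B : Set α))
    (himp : ∃ e, e ∉ B ∧ ∃ y ∈ exchangeable M B e, μ y < μ e) (T : ℕ) :
    (leaderTime L B T : ℝ) ≤
      (9 + 4 * s₀ + 6 * ((Fintype.card α - rank M + 1 : ℕ) : ℝ)) * (1 + V) := by
  have hcard := card_sub_rank_add_one hB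
  have hcard2 : 2 ≤ Fintype.card α - rank M + 1 := by
    obtain ⟨e, he, -⟩ := himp
    have : 0 < (Finset.univ \ B).card := Finset.card_pos.2 ⟨e, by simpa using he⟩
    omega
  set k := Fintype.card α - rank M + 1 with hk
  have hk2 : (2 : ℝ) ≤ k := by exact_mod_cast hcard2
  have hs₀' : (0 : ℝ) ≤ s₀ := Nat.cast_nonneg _
  rcases lt_or_ge (leaderTime L B T) s₀ with hlt | hge
  · have : (leaderTime L B T : ℝ) ≤ s₀ := by exact_mod_cast hlt.le
    nlinarith [mul_nonneg hs₀' hV0]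
  set S := leaderTime L B T with hS
  set h₁ : ℝ := s₀ + k * V + 2 with hh₁
  set H : ℝ := V + Real.log S / (8 * ε ^ 2) with hH
  have hlogS := Real.log_natCast_nonneg S
  have hH0 : 0 ≤ H := by positivity
  have hsub : (Finset.Icc 1 T).filter (fun s => L s = B) ⊆
      ((Finset.Icc 1 T).filter (fun s => L s = B ∧ (leaderTime L B s : ℝ) ≤ h₁) ∪
        (Finset.Icc 1 T).filter (fun s => L s = B ∧ k ∣ leaderTime L B s - 1)) ∪
      (Finset.univ \ B).biUnion fun f =>
        (Finset.Icc 1 T).filter (fun s => f ∈ P s ∧ (plays P f (s - 1) : ℝ) ≤ H) := by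
    intro s hs
    obtain ⟨hsT, hsB⟩ := Finset.mem_filter.1 hs
    obtain ⟨t, rfl⟩ : ∃ t, s = t + 1 := ⟨s - 1, by have := (Finset.mem_Icc.1 hsT).1; omega⟩
    simp only [Finset.mem_union, Finset.mem_biUnion, Finset.mem_filter, hsT, true_and, hsB,
      Nat.add_sub_cancel]
    rcases le_or_gt (leaderTime L B (t + 1) : ℝ) h₁ with hle | hgt
    · exact Or.inl (Or.inl hle)
    · rcases hV.suboptimal_round hV0 h hE hM hμ hε0 hε hs₀ (t := t)
        (by rw [hsB]; exact hgt.le) (by rw [hsB]; exact himp) with hd | ⟨f, hf, hfP, hpl⟩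
      · rw [hsB] at hd
        exact Or.inl (Or.inr hd)
      · rw [hsB] at hf hpl
        refine Or.inr ⟨f, by simpa using hf, hfP, hpl.trans ?_⟩
        have hpos : 0 < leaderTime L B (t + 1) := by
          rw [leaderTime_succ_of_eq hsB]; omega
        have hle : leaderTime L B (t + 1) ≤ S :=
          leaderTime_mono L B (Finset.mem_Icc.1 hsT).2
        have := Real.log_le_log (by exact_mod_cast hpos) (Nat.cast_le (α := ℝ).2 hle)
        rw [hH]
        gcongr
  have hc := (Finset.card_le_card hsub).trans ((Finset.card_union_le _ _).trans
    (add_le_add (Finset.card_union_le _ _) Finset.card_biUnion_le))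
  have hcR : (S : ℝ) ≤ (((Finset.Icc 1 T).filter
        (fun s => L s = B ∧ (leaderTime L B s : ℝ) ≤ h₁)).card : ℝ) +
      (((Finset.Icc 1 T).filter (fun s => L s = B ∧ k ∣ leaderTime L B s - 1)).card : ℝ) +
      ∑ f ∈ Finset.univ \ B, (((Finset.Icc 1 T).filter
        (fun s => f ∈ P s ∧ (plays P f (s - 1) : ℝ) ≤ H)).card : ℝ) := by
    exact_mod_cast hc
  have hc1 := card_filter_count_le (fun s => L s = B) (h := h₁) (by positivity) T
  have hc2 : (k : ℝ) * (((Finset.Icc 1 T).filter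
      (fun s => L s = B ∧ k ∣ leaderTime L B s - 1)).card : ℝ) ≤ S + k := by
    exact_mod_cast mul_card_filter_dvd_le L B k T (by omega)
  have hc3 : ∑ f ∈ Finset.univ \ B, (((Finset.Icc 1 T).filter
      (fun s => f ∈ P s ∧ (plays P f (s - 1) : ℝ) ≤ H)).card : ℝ) ≤ k * H := by
    refine (Finset.sum_le_sum fun f _ => card_filter_plays_le P f hH0 T).trans ?_
    rw [Finset.sum_const, nsmul_eq_mul]
    refine mul_le_mul_of_nonneg_right ?_ hH0
    exact_mod_cast (by omega : (Finset.univ \ B).card ≤ k)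
  -- beyond `s₀` the logarithmic terms amount to at most a sixteenth of all leaderships
  have hkH : k * H ≤ k * V + S / 16 := by
    have := hs₀ S hge
    have h2 : k * (Real.log S / (8 * ε ^ 2)) ≤ S / 16 := by
      rw [mul_div_assoc', div_le_iff₀ (by positivity)]
      linarith
    rw [hH, mul_add]
    linarith
  set n₂ : ℝ := (((Finset.Icc 1 T).filter
      (fun s => L s = B ∧ k ∣ leaderTime L B s - 1)).card : ℝ) with hn₂
  -- `k ≥ 2`, as some element lies outside `B`
  have hn₂' : n₂ ≤ S / 2 + 1 := by
    by_contra! hcon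
    have hS0 : (0 : ℝ) ≤ S := Nat.cast_nonneg _
    nlinarith
  have hc1' : (((Finset.Icc 1 T).filter
      (fun s => L s = B ∧ (leaderTime L B s : ℝ) ≤ h₁)).card : ℝ) ≤ h₁ := hc1
  have hfin : (S : ℝ) ≤ 16 / 7 * (h₁ + 1 + k * V) := by linarith
  rw [hh₁] at hfin
  have := mul_nonneg hs₀' hV0
  have := mul_nonneg (by linarith : (0 : ℝ) ≤ k) hV0
  nlinarith

/-- Pathwise regret bound: up to a multiple of `1 + V`, only the exploration of the neighbours of
the optimal base costs. -/
lemma exists_regret_le (hE : M.E = Set.univ) (hM : M.Loopless) (hμ_pos : ∀ e, 0 < μ e)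
    (hμ : Function.Injective μ) (hBs : M.IsBase (Bs : Set α))
    (hmax : ∀ I : Finset α, M.Indep (I : Set α) → I ≠ Bs → value μ I < value μ Bs)
    (hε0 : 0 < ε) (hε : IsSeparated μ ε) :
    ∃ C : ℝ, ∀ (x : α → ℕ → ℝ) (L : ℕ → Finset α) (q : ℕ → List α)
      (N : ℕ → Finset (Finset α)) (P : ℕ → Finset α) (V : ℝ), 0 ≤ V →
      IsExecution M x L q N P → IsTypicalPath μ ε V x P → ∀ T : ℕ,
      regret M μ P T ≤
        (∑ e ∈ Finset.univ \ Bs, 8 / gap M Bs μ e) * Real.log T + C * (1 + V) := by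
  set k := Fintype.card α - rank M + 1 with hk
  have hk0 : (0 : ℝ) < k := by exact_mod_cast Nat.succ_pos _
  obtain ⟨s₀, hs₀⟩ := exists_forall_log_le (c := 2 * (k : ℝ)) (ε := ε ^ 2) (by positivity)
    (by positivity)
  have hs₀' : (0 : ℝ) ≤ s₀ := Nat.cast_nonneg _
  have hval0 : ∀ I : Finset α, 0 ≤ value μ I := fun I => Finset.sum_nonneg fun e _ => (hμ_pos e).le
  set opt := optValue M μ with hopt
  have hopt' : opt = value μ Bs := optValue_eq hBs hmax
  have hopt0 : 0 ≤ opt := hopt' ▸ hval0 _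
  have hgap : ∀ e, e ∉ Bs → 0 < gap M Bs μ e := fun e he => gap_pos hE hM hBs hmax he
  set C₁ : ℝ := 9 + 4 * s₀ + 6 * (k : ℝ) with hC₁
  have hC₁0 : 0 ≤ C₁ := by positivity
  set G : ℝ := ∑ e ∈ Finset.univ \ Bs, gap M Bs μ e with hG
  have hG0 : 0 ≤ G := Finset.sum_nonneg fun e he => (hgap e (Finset.mem_sdiff.1 he).2).le
  set m : ℝ := ((Finset.univ.erase Bs : Finset (Finset α)).card : ℝ) with hm
  set I₀ : ℝ := |∑ e, (opt - value μ {e})| with hI₀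
  refine ⟨I₀ + m * (opt * C₁) + opt * k + G, ?_⟩
  intro x L q N P V hV0 h hV T
  have hlogT := Real.log_natCast_nonneg T
  set H : α → ℝ := fun e => V + 8 * Real.log T / gap M Bs μ e ^ 2 with hH
  have hH0 : ∀ e, 0 ≤ H e := fun e => by positivity
  -- a round costs at most `opt` under a suboptimal leader or an early optimal one, and otherwise the
  -- gap of the element swapped in
  have hround : ∀ s ∈ Finset.Icc 1 T, opt - value μ (P s) ≤
      (∑ B ∈ Finset.univ.erase Bs, if L s = B then opt else 0) +
      (if L s = Bs ∧ (leaderTime L Bs s : ℝ) ≤ k * V then opt else 0) +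
      ∑ e ∈ Finset.univ \ Bs,
        if e ∈ P s ∧ (plays P e (s - 1) : ℝ) ≤ H e then gap M Bs μ e else 0 := by
    intro s hs
    obtain ⟨t, rfl⟩ : ∃ t, s = t + 1 := ⟨s - 1, by have := (Finset.mem_Icc.1 hs).1; omega⟩
    have hnn1 : 0 ≤ ∑ B ∈ Finset.univ.erase Bs, if L (t + 1) = B then opt else 0 :=
      Finset.sum_nonneg fun B _ => by split_ifs <;> simp [hopt0]
    have hnn2 : 0 ≤ if L (t + 1) = Bs ∧ (leaderTime L Bs (t + 1) : ℝ) ≤ k * V then opt else 0 := by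
      split_ifs <;> simp [hopt0]
    have hnn3' : ∀ e ∈ Finset.univ \ Bs,
        0 ≤ if e ∈ P (t + 1) ∧ (plays P e (t + 1 - 1) : ℝ) ≤ H e then gap M Bs μ e else 0 := by
      intro e he
      have := (hgap e (Finset.mem_sdiff.1 he).2).le
      split_ifs <;> simp [this]
    have hnn3 := Finset.sum_nonneg hnn3'
    have hPv := hval0 (P (t + 1))
    by_cases hL : L (t + 1) = Bs
    · by_cases hle : (leaderTime L Bs (t + 1) : ℝ) ≤ k * V
      · rw [if_pos ⟨hL, hle⟩]
        linarith
      · have hlt : (k : ℝ) * V < leaderTime L (L (t + 1)) t + 1 := by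
          rw [leaderTime_succ_of_eq hL] at hle
          push_cast at hle
          rw [hL]
          exact not_le.1 hle
        rcases hV.optimal_round h hE hM hμ hε hlt (by rw [hL]; exact hgap) with
          hP | ⟨e, he, hP, hpl⟩
        · have hv : opt - value μ (P (t + 1)) = 0 := by rw [hP, hL, hopt', sub_self]
          linarith
        · rw [hL] at he hP hpl
          have hσ := mem_exchangeable.1
            (sigma_mem (w := μ) (exchangeable_nonempty hE hM hBs he))
          have heP : e ∈ P (t + 1) := by rw [hP]; exact Finset.mem_insert_self _ _
          have hplH : (plays P e t : ℝ) ≤ H e := by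
            have hpos : 0 < leaderTime L Bs (t + 1) := by
              rw [leaderTime_succ_of_eq hL]; omega
            have hle : leaderTime L Bs (t + 1) ≤ T :=
              (leaderTime_le L Bs _).trans (Finset.mem_Icc.1 hs).2
            have hlog := Real.log_le_log (by exact_mod_cast hpos) (Nat.cast_le (α := ℝ).2 hle)
            have hnn : 0 ≤ 8 * Real.log T / gap M Bs μ e ^ 2 := by positivity
            rcases hpl with hpl | hpl
            · simp only [hH]
              linarith
            · refine hpl.trans ?_
              simp only [hH]
              have : 8 * Real.log (leaderTime L Bs (t + 1)) / gap M Bs μ e ^ 2 ≤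
                  8 * Real.log T / gap M Bs μ e ^ 2 := by gcongr
              linarith
          have hsingle := Finset.single_le_sum hnn3' (a := e) (by simpa using he)
          rw [if_pos ⟨heP, by simpa using hplH⟩] at hsingle
          have hv : opt - value μ (P (t + 1)) = gap M Bs μ e := by
            rw [hP, value_swap μ hσ.1 he, hopt', gap]
            ring
          linarith
    · have hsingle := Finset.single_le_sum
        (f := fun B => if L (t + 1) = B then opt else 0) (s := Finset.univ.erase Bs)
        (fun B _ => by split_ifs <;> simp [hopt0]) (a := L (t + 1)) (by simpa using hL)
      simp only [if_true] at hsingle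
      linarith
  have hcount : ∀ (p : ℕ → Prop) [DecidablePred p] (c : ℝ),
      ∑ s ∈ Finset.Icc 1 T, (if p s then c else 0) = ((Finset.Icc 1 T).filter p).card * c := by
    intro p _ c
    rw [← Finset.sum_filter, Finset.sum_const, nsmul_eq_mul]
  have hsum := Finset.sum_le_sum hround
  rw [Finset.sum_add_distrib, Finset.sum_add_distrib, Finset.sum_comm, hcount,
    Finset.sum_comm (s := Finset.Icc 1 T) (t := Finset.univ \ Bs)] at hsum
  simp only [hcount] at hsum
  have hb1 : ∑ B ∈ Finset.univ.erase Bs,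
      (((Finset.Icc 1 T).filter fun s => L s = B).card : ℝ) * opt ≤
        m * (opt * C₁ * (1 + V)) := by
    rw [hm, ← nsmul_eq_mul]
    refine Finset.sum_le_card_nsmul _ _ _ fun B hB => ?_
    have hle : (leaderTime L B T : ℝ) ≤ C₁ * (1 + V) := by
      by_cases hbase : M.IsBase (B : Set α)
      · exact hV.leaderTime_le hV0 h hE hM hμ hε0 hε hs₀ hbase
          (exists_improving_swap hμ hBs hmax hbase (Finset.mem_erase.1 hB).1) T
      · have : leaderTime L B T = 0 := by
          rw [leaderTime, Finset.card_eq_zero, Finset.filter_eq_empty_iff]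
          rintro s - rfl
          exact hbase (h.isBase_leader s)
        rw [this, Nat.cast_zero]
        positivity
    calc _ ≤ C₁ * (1 + V) * opt := mul_le_mul_of_nonneg_right hle hopt0
      _ = opt * C₁ * (1 + V) := by ring
  have hb2 := mul_le_mul_of_nonneg_right
    (card_filter_count_le (fun s => L s = Bs) (h := k * V) (by positivity) T) hopt0
  have hb3 : ∑ e ∈ Finset.univ \ Bs, (((Finset.Icc 1 T).filter fun s =>
      e ∈ P s ∧ (plays P e (s - 1) : ℝ) ≤ H e).card : ℝ) * gap M Bs μ e ≤
      G * V + (∑ e ∈ Finset.univ \ Bs, 8 / gap M Bs μ e) * Real.log T := by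
    rw [hG, Finset.sum_mul, Finset.sum_mul, ← Finset.sum_add_distrib]
    refine Finset.sum_le_sum fun e he => ?_
    have hg := hgap e (Finset.mem_sdiff.1 he).2
    refine (mul_le_mul_of_nonneg_right (card_filter_plays_le P e (hH0 e) T) hg.le).trans
      (le_of_eq ?_)
    simp only [hH]
    field_simp
  have hb0 : ∑ e, (opt - value μ {e}) ≤ I₀ := le_abs_self _
  have hreg : regret M μ P T =
      ∑ e, (opt - value μ {e}) + ∑ s ∈ Finset.Icc 1 T, (opt - value μ (P s)) := rfl
  have hI₀V : 0 ≤ I₀ * V := mul_nonneg (abs_nonneg _) hV0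
  have hkopt : 0 ≤ opt * k := by positivity
  rw [hreg]
  have hb2' : (((Finset.Icc 1 T).filter fun s =>
      L s = Bs ∧ (leaderTime L Bs s : ℝ) ≤ k * V).card : ℝ) * opt ≤ k * V * opt := hb2
  linarith

end PathwiseRegret

/-! ### Deviation inequality for adaptively many samples -/

section TruncatedSum

variable {α : Type*} [DecidableEq α] {P : ℕ → Finset α} {e : α} {n t T : ℕ}

/-- Sum of `y` over the first `n` of the times, up to `t`, at which `e` is sampled; the sample at
time `0` is always included. -/
def truncSum (y : ℕ → ℝ) (P : ℕ → Finset α) (e : α) (n : ℕ) : ℕ → ℝ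
  | 0 => y 0
  | t + 1 => truncSum y P e n t + if e ∈ P (t + 1) ∧ plays P e t < n then y (t + 1) else 0

lemma truncSum_eq_of_plays_le (y : ℕ → ℝ) (h : plays P e t ≤ n) :
    truncSum y P e n t = y 0 + ∑ s ∈ (Finset.Icc 1 t).filter (fun s => e ∈ P s), y s := by
  induction t with
  | zero => simp [truncSum]
  | succ t ih =>
    rw [truncSum, ih (plays_le_succ.trans h), ← Finset.insert_Icc_right_eq_Icc_add_one (by omega),
      Finset.filter_insert]
    by_cases he : e ∈ P (t + 1)
    · have hlt : plays P e t < n := by rw [plays_succ_of_mem he] at h; omega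
      rw [if_pos ⟨he, hlt⟩, if_pos he, Finset.sum_insert (by simp)]
      ring
    · rw [if_neg fun hc => he hc.1, if_neg he, add_zero]

lemma truncSum_eq_of_le_plays (y : ℕ → ℝ) (h : n ≤ plays P e t) (hT : t ≤ T) :
    truncSum y P e n T = truncSum y P e n t := by
  suffices H : truncSum y P e n T = truncSum y P e n t ∧ n ≤ plays P e T from H.1
  induction T, hT using Nat.le_induction with
  | base => exact ⟨rfl, h⟩
  | succ T _ ih =>
    refine ⟨?_, ih.2.trans plays_le_succ⟩
    rw [truncSum, if_neg fun hc => absurd hc.2 (not_lt.2 ih.2), add_zero, ih.1]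

/-- The exponent of the exponential supermartingale of the centred samples of `e`, stopped after
`n` samples, keeps from the `n`-th sample on the value determined by the empirical mean. -/
lemma truncSum_exponent (x : α → ℕ → ℝ) (m c : ℝ) (h : plays P e t = n) (hT : t ≤ T) :
    truncSum (fun s => c * (x e s - m) - c ^ 2 / 8) P e n T =
      n * (c * (empMean x P t e - m) - c ^ 2 / 8) := by
  rw [truncSum_eq_of_le_plays _ h.ge hT, truncSum_eq_of_plays_le _ h.le]
  have hn : (n : ℝ) ≠ 0 := by
    rw [← h]
    exact Nat.cast_ne_zero.2 plays_pos.ne'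
  have hcard : (n : ℝ) = 1 + ((Finset.Icc 1 t).filter fun s => e ∈ P s).card := by
    rw [← h, plays]
    push_cast
    rfl
  rw [empMean, h, Finset.sum_sub_distrib, ← Finset.mul_sum, Finset.sum_sub_distrib,
    Finset.sum_const, Finset.sum_const, nsmul_eq_mul, nsmul_eq_mul]
  have hmul : ∀ a : ℝ, (n : ℝ) * (c * (a / n - m) - c ^ 2 / 8) =
      c * a - n * (c * m) - n * (c ^ 2 / 8) := by
    intro a
    field_simp
  rw [hmul, hcard]
  ring

end TruncatedSum

section Environment

variable {α : Type*} {μ : α → ℝ} {Ω : Type*} [mΩ : MeasurableSpace Ω] {Pr : Measure Ω}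
  {ℱ : Filtration ℕ mΩ} {X : α → ℕ → Ω → ℝ}

lemma IsEnvironment.lintegral_exp_le_one (hX : IsEnvironment Pr ℱ X μ) (e : α) (c : ℝ) (t : ℕ) :
    ∫⁻ ω, ENNReal.ofReal (Real.exp (c * (X e t ω - μ e) - c ^ 2 / 8)) ∂Pr ≤ 1 := by
  have hs := hX.subGaussian e t
  have hfun : (fun ω => Real.exp (c * (X e t ω - μ e) - c ^ 2 / 8)) =
      fun ω => Real.exp (c * (X e t ω - μ e)) * Real.exp (-(c ^ 2 / 8)) := by
    ext ω
    rw [← Real.exp_add, sub_eq_add_neg]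
  have hint : Integrable (fun ω => Real.exp (c * (X e t ω - μ e) - c ^ 2 / 8)) Pr := by
    rw [hfun]
    exact (hs.integrable_exp_mul c).mul_const _
  rw [← ofReal_integral_eq_lintegral_ofReal hint (ae_of_all _ fun _ => (Real.exp_pos _).le),
    ENNReal.ofReal_le_one, hfun, integral_mul_const]
  have hm := hs.mgf_le c
  rw [mgf] at hm
  calc _ ≤ Real.exp (((1 / 4 : NNReal) : ℝ) * c ^ 2 / 2) * Real.exp (-(c ^ 2 / 8)) :=
        mul_le_mul_of_nonneg_right hm (Real.exp_pos _).le
    _ = 1 := by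
        rw [← Real.exp_add, Real.exp_eq_one_iff]
        push_cast
        ring

/-- A quantitative Borel-Cantelli lemma: the last index at which one of the events occurs is
bounded by an integrable function. -/
lemma exists_lintegral_ne_top_of_tsum {A : ℕ → Set Ω} {b : ℕ → ℝ}
    (hA : ∀ n, Pr (A n) ≤ ENNReal.ofReal (b n)) (hb : Summable fun n : ℕ => n * b n) :
    ∃ W : Ω → ENNReal, Measurable W ∧ ∫⁻ ω, W ω ∂Pr ≠ ⊤ ∧
      ∀ n ω, ω ∈ A n → (n : ENNReal) ≤ W ω := by
  have hind : ∀ n : ℕ, Measurable ((toMeasurable Pr (A n)).indicator fun _ => (n : ENNReal)) :=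
    fun n => measurable_const.indicator (measurableSet_toMeasurable _ _)
  refine ⟨fun ω => ∑' n : ℕ, (toMeasurable Pr (A n)).indicator (fun _ => (n : ENNReal)) ω,
    Measurable.tsum hind, ?_, ?_⟩
  · rw [lintegral_tsum fun n => (hind n).aemeasurable]
    refine ne_top_of_le_ne_top hb.tsum_ofReal_ne_top (ENNReal.tsum_le_tsum fun n => ?_)
    rw [lintegral_indicator_const (measurableSet_toMeasurable _ _), measure_toMeasurable,
      ENNReal.ofReal_mul (Nat.cast_nonneg _), ENNReal.ofReal_natCast]
    gcongr
    exact hA n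
  · intro n ω hω
    refine le_trans ?_ (ENNReal.le_tsum n)
    rw [Set.indicator_of_mem (subset_toMeasurable _ _ hω)]

end Environment

section Deviation

variable {α : Type*} [Fintype α] [DecidableEq α] {M : Matroid α} {μ : α → ℝ}
  {Ω : Type*} [mΩ : MeasurableSpace Ω] {Pr : Measure Ω} {ℱ : Filtration ℕ mΩ}
  {X : α → ℕ → Ω → ℝ} {L : ℕ → Ω → Finset α} {q : ℕ → Ω → List α}
  {N : ℕ → Ω → Finset (Finset α)} {P : ℕ → Ω → Finset α}

lemma IsMAUB.measurableSet_played_eq (h : IsMAUB M ℱ X L q N P) (t : ℕ) (J : Finset α) :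
    MeasurableSet[ℱ t] {ω | P (t + 1) ω = J} := by
  have : {ω | P (t + 1) ω = J} = ⋃ (B : Finset α) (l : List α) (S : Finset (Finset α)),
      {ω | L (t + 1) ω = B ∧ q (t + 1) ω = l ∧ N (t + 1) ω = S ∧ P (t + 1) ω = J} := by
    ext ω
    simp
  rw [this]
  exact MeasurableSet.iUnion fun B => MeasurableSet.iUnion fun l => MeasurableSet.iUnion fun S =>
    h.predictable t B l S J

lemma IsMAUB.measurableSet_mem_played (h : IsMAUB M ℱ X L q N P) (t : ℕ) (e : α) :
    MeasurableSet[ℱ t] {ω | e ∈ P (t + 1) ω} := by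
  have : {ω | e ∈ P (t + 1) ω} = ⋃ (J : Finset α) (_ : e ∈ J), {ω | P (t + 1) ω = J} := by
    ext ω
    simp
  rw [this]
  exact MeasurableSet.iUnion fun J => MeasurableSet.iUnion fun _ => h.measurableSet_played_eq t J

lemma IsMAUB.measurable_plays (h : IsMAUB M ℱ X L q N P) (e : α) (t : ℕ) :
    Measurable[ℱ t] fun ω => plays (fun s => P s ω) e t := by
  induction t with
  | zero => simp only [plays_zero]; exact measurable_const
  | succ t ih =>
    have hrec : (fun ω => plays (fun s => P s ω) e (t + 1)) = fun ω =>
        plays (fun s => P s ω) e t + {ω | e ∈ P (t + 1) ω}.indicator (fun _ => 1) ω := by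
      ext ω
      by_cases he : e ∈ P (t + 1) ω
      · rw [plays_succ_of_mem (P := fun s => P s ω) he, Set.indicator_of_mem (by exact he)]
      · rw [plays_succ_of_notMem (P := fun s => P s ω) he, Set.indicator_of_notMem (by exact he),
          add_zero]
    rw [hrec]
    have hle := ℱ.mono (Nat.le_succ t)
    exact (ih.mono hle le_rfl).add
      (measurable_const.indicator (hle _ (h.measurableSet_mem_played t e)))

lemma IsMAUB.measurableSet_counted (h : IsMAUB M ℱ X L q N P) (e : α) (n t : ℕ) :
    MeasurableSet[ℱ t] {ω | e ∈ P (t + 1) ω ∧ plays (fun s => P s ω) e t < n} := by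
  have h1 : MeasurableSet[ℱ t] {ω | plays (fun s => P s ω) e t < n} :=
    h.measurable_plays e t (measurableSet_lt measurable_id measurable_const)
  exact (h.measurableSet_mem_played t e).inter h1

lemma IsMAUB.measurable_truncSum (h : IsMAUB M ℱ X L q N P) (hX : IsEnvironment Pr ℱ X μ)
    (e : α) (n : ℕ) (c : ℝ) (t : ℕ) :
    Measurable[ℱ t] fun ω => truncSum (fun s => c * (X e s ω - μ e) - c ^ 2 / 8)
      (fun s => P s ω) e n t := by
  induction t with
  | zero => exact (((hX.adapted e 0).sub_const _).const_mul c).sub_const _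
  | succ t ih =>
    have hle := ℱ.mono (Nat.le_succ t)
    simp only [truncSum]
    refine (ih.mono hle le_rfl).add (Measurable.ite (hle _ (h.measurableSet_counted e n t)) ?_
      measurable_const)
    exact (((hX.adapted e (t + 1)).sub_const _).const_mul c).sub_const _

/-- The exponential process of the stopped sum is a supermartingale, because the decision to sample
`e` precedes the sample. -/
lemma IsMAUB.lintegral_exp_truncSum_le_one (h : IsMAUB M ℱ X L q N P)
    (hX : IsEnvironment Pr ℱ X μ) (e : α) (n : ℕ) (c : ℝ) (t : ℕ) :
    ∫⁻ ω, ENNReal.ofReal (Real.exp (truncSum (fun s => c * (X e s ω - μ e) - c ^ 2 / 8)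
      (fun s => P s ω) e n t)) ∂Pr ≤ 1 := by
  induction t with
  | zero => exact hX.lintegral_exp_le_one e c 0
  | succ t ih =>
    set F : Ω → ENNReal := fun ω => ENNReal.ofReal (Real.exp
      (truncSum (fun s => c * (X e s ω - μ e) - c ^ 2 / 8) (fun s => P s ω) e n t)) with hF
    set Z : Ω → ENNReal := fun ω =>
      ENNReal.ofReal (Real.exp (c * (X e (t + 1) ω - μ e) - c ^ 2 / 8)) with hZ
    set Q : Set Ω := {ω | e ∈ P (t + 1) ω ∧ plays (fun s => P s ω) e t < n} with hQ
    have hQm : MeasurableSet[ℱ t] Q := h.measurableSet_counted e n t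
    have hFm : Measurable[ℱ t] F :=
      (Real.measurable_exp.comp (h.measurable_truncSum hX e n c t)).ennreal_ofReal
    have hcoord : Measurable[MeasurableSpace.comap (fun ω e => X e (t + 1) ω) MeasurableSpace.pi]
        (X e (t + 1)) :=
      (measurable_pi_apply e).comp (comap_measurable fun ω e => X e (t + 1) ω)
    have hZm : Measurable[MeasurableSpace.comap (fun ω e => X e (t + 1) ω) MeasurableSpace.pi] Z :=
      (Real.measurable_exp.comp (((hcoord.sub_const _).const_mul c).sub_const _)).ennreal_ofReal
    have hle : MeasurableSpace.comap (fun ω e => X e (t + 1) ω) MeasurableSpace.pi ≤ mΩ :=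
      measurable_iff_comap_le.1 (measurable_pi_lambda _ fun e =>
        (hX.adapted e (t + 1)).mono (ℱ.le _) le_rfl)
    have hsplit : (fun ω => ENNReal.ofReal (Real.exp (truncSum
        (fun s => c * (X e s ω - μ e) - c ^ 2 / 8) (fun s => P s ω) e n (t + 1)))) =
        fun ω => Q.indicator F ω * Z ω + Qᶜ.indicator F ω := by
      ext ω
      by_cases hω : ω ∈ Q
      · rw [Set.indicator_of_mem hω, Set.indicator_of_notMem (by simpa using hω), add_zero, hF, hZ,
          ← ENNReal.ofReal_mul (Real.exp_pos _).le, ← Real.exp_add, truncSum,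
          if_pos (by exact hω)]
      · rw [Set.indicator_of_notMem hω, Set.indicator_of_mem (by exact hω), zero_mul, zero_add,
          hF, truncSum, if_neg (by exact hω), add_zero]
    have hQF : Measurable[ℱ t] (Q.indicator F) := hFm.indicator hQm
    rw [hsplit, lintegral_add_right _ ((hFm.mono (ℱ.le t) le_rfl).indicator (ℱ.le t _ hQm).compl),
      lintegral_mul_eq_lintegral_mul_lintegral_of_independent_measurableSpace (ℱ.le t) hle
        (hX.indep t).symm hQF hZm]
    calc _ ≤ (∫⁻ ω, Q.indicator F ω ∂Pr) * 1 + ∫⁻ ω, Qᶜ.indicator F ω ∂Pr := by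
          gcongr
          exact hX.lintegral_exp_le_one e c (t + 1)
      _ = ∫⁻ ω, F ω ∂Pr := by
          rw [mul_one, lintegral_indicator (ℱ.le t _ hQm), lintegral_indicator (ℱ.le t _ hQm).compl,
            lintegral_add_compl _ (ℱ.le t _ hQm)]
      _ ≤ 1 := ih

/-- Chernoff bound, uniformly over the random time of the `n`-th sample. -/
lemma IsMAUB.measure_exponent_ge_le (h : IsMAUB M ℱ X L q N P) (hX : IsEnvironment Pr ℱ X μ)
    (e : α) (n : ℕ) (c b : ℝ) :
    Pr {ω | ∃ t, plays (fun s => P s ω) e t = n ∧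
      b ≤ n * (c * (empMean (fun e s => X e s ω) (fun s => P s ω) t e - μ e) - c ^ 2 / 8)} ≤
      ENNReal.ofReal (Real.exp (-b)) := by
  set E : ℕ → Set Ω := fun T => {ω | ∃ t ≤ T, plays (fun s => P s ω) e t = n ∧
      b ≤ n * (c * (empMean (fun e s => X e s ω) (fun s => P s ω) t e - μ e) - c ^ 2 / 8)} with hE
  have hmono : Monotone E := fun T T' hT ω ⟨t, ht, h1⟩ => ⟨t, ht.trans hT, h1⟩
  have hunion : {ω | ∃ t, plays (fun s => P s ω) e t = n ∧
      b ≤ n * (c * (empMean (fun e s => X e s ω) (fun s => P s ω) t e - μ e) - c ^ 2 / 8)} =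
      ⋃ T, E T := by
    ext ω
    simp only [Set.mem_ofPred_eq, Set.mem_iUnion, hE]
    exact ⟨fun ⟨t, ht⟩ => ⟨t, t, le_rfl, ht⟩, fun ⟨_, t, _, ht⟩ => ⟨t, ht⟩⟩
  rw [hunion, hmono.measure_iUnion]
  refine iSup_le fun T => ?_
  have hsub : E T ⊆ {ω | ENNReal.ofReal (Real.exp b) ≤ ENNReal.ofReal (Real.exp
      (truncSum (fun s => c * (X e s ω - μ e) - c ^ 2 / 8) (fun s => P s ω) e n T))} := by
    rintro ω ⟨t, ht, hn, hb⟩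
    refine ENNReal.ofReal_le_ofReal (Real.exp_le_exp.2 ?_)
    rw [truncSum_exponent (fun e s => X e s ω) (μ e) c hn ht]
    exact hb
  have hmeas : Measurable fun ω => ENNReal.ofReal (Real.exp
      (truncSum (fun s => c * (X e s ω - μ e) - c ^ 2 / 8) (fun s => P s ω) e n T)) :=
    (Real.measurable_exp.comp
      ((h.measurable_truncSum hX e n c T).mono (ℱ.le T) le_rfl)).ennreal_ofReal
  have hmarkov := (mul_meas_ge_le_lintegral hmeas (ENNReal.ofReal (Real.exp b))).trans
    (h.lintegral_exp_truncSum_le_one hX e n c T)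
  refine (measure_mono hsub).trans ?_
  rw [Real.exp_neg, ENNReal.ofReal_inv_of_pos (Real.exp_pos _), ENNReal.le_inv_iff_mul_le, mul_comm]
  exact hmarkov

/-- The empirical mean of `n` samples is too low by `δ` with probability at most
`exp (-2 n δ²)`. -/
lemma IsMAUB.measure_le_sub_le (h : IsMAUB M ℱ X L q N P) (hX : IsEnvironment Pr ℱ X μ)
    (e : α) (n : ℕ) {δ : ℝ} (hδ : 0 ≤ δ) :
    Pr {ω | ∃ t, plays (fun s => P s ω) e t = n ∧
      empMean (fun e s => X e s ω) (fun s => P s ω) t e ≤ μ e - δ} ≤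
      ENNReal.ofReal (Real.exp (-(2 * n * δ ^ 2))) := by
  -- `∓ 4 δ` is the optimal exponent for the variance proxy `1 / 4`
  refine (measure_mono ?_).trans (h.measure_exponent_ge_le hX e n (-(4 * δ)) (2 * n * δ ^ 2))
  rintro ω ⟨t, hn, ht⟩
  refine ⟨t, hn, ?_⟩
  have hn0 : (0 : ℝ) ≤ n := Nat.cast_nonneg _
  nlinarith [mul_nonneg hn0 (mul_nonneg hδ (sub_nonneg.2 ht))]

lemma IsMAUB.measure_add_le_le (h : IsMAUB M ℱ X L q N P) (hX : IsEnvironment Pr ℱ X μ)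
    (e : α) (n : ℕ) {δ : ℝ} (hδ : 0 ≤ δ) :
    Pr {ω | ∃ t, plays (fun s => P s ω) e t = n ∧
      μ e + δ ≤ empMean (fun e s => X e s ω) (fun s => P s ω) t e} ≤
      ENNReal.ofReal (Real.exp (-(2 * n * δ ^ 2))) := by
  refine (measure_mono ?_).trans (h.measure_exponent_ge_le hX e n (4 * δ) (2 * n * δ ^ 2))
  rintro ω ⟨t, hn, ht⟩
  refine ⟨t, hn, ?_⟩
  have hn0 : (0 : ℝ) ≤ n := Nat.cast_nonneg _
  nlinarith [mul_nonneg hn0 (mul_nonneg hδ (sub_nonneg.2 ht))]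

lemma IsMAUB.measure_abs_ge_le (h : IsMAUB M ℱ X L q N P) (hX : IsEnvironment Pr ℱ X μ)
    (e : α) (n : ℕ) {ε : ℝ} (hε : 0 ≤ ε) :
    Pr {ω | ∃ t, plays (fun s => P s ω) e t = n ∧
      ε ≤ |empMean (fun e s => X e s ω) (fun s => P s ω) t e - μ e|} ≤
      ENNReal.ofReal (2 * Real.exp (-(2 * n * ε ^ 2))) := by
  rw [two_mul (Real.exp _), ENNReal.ofReal_add (Real.exp_pos _).le (Real.exp_pos _).le]
  refine le_trans ?_ (add_le_add (h.measure_le_sub_le hX e n hε) (h.measure_add_le_le hX e n hε))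
  refine (measure_mono ?_).trans (measure_union_le _ _)
  rintro ω ⟨t, hn, ht⟩
  rcases le_abs'.1 ht with ht | ht
  · exact Or.inl ⟨t, hn, by linarith⟩
  · exact Or.inr ⟨t, hn, by linarith⟩

/-- Union bound over the at most `s` possible sample sizes: the exploration bonus with `log s`
fails with probability at most `s ^ (-3)`. -/
lemma IsMAUB.measure_index_lt_le (h : IsMAUB M ℱ X L q N P) (hX : IsEnvironment Pr ℱ X μ)
    (e : α) (s : ℕ) :
    Pr {ω | ∃ t, plays (fun s => P s ω) e t ≤ s ∧
      empMean (fun e s => X e s ω) (fun s => P s ω) t e +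
        Real.sqrt (2 * Real.log s / plays (fun s => P s ω) e t) < μ e} ≤
      ENNReal.ofReal (s * (1 / (s : ℝ) ^ 4)) := by
  have hlog := Real.log_natCast_nonneg s
  have hsub : {ω | ∃ t, plays (fun s => P s ω) e t ≤ s ∧
      empMean (fun e s => X e s ω) (fun s => P s ω) t e +
        Real.sqrt (2 * Real.log s / plays (fun s => P s ω) e t) < μ e} ⊆
      ⋃ n ∈ Finset.Icc 1 s, {ω | ∃ t, plays (fun s => P s ω) e t = n ∧
        empMean (fun e s => X e s ω) (fun s => P s ω) t e ≤
          μ e - Real.sqrt (2 * Real.log s / n)} := by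
    rintro ω ⟨t, hs, ht⟩
    simp only [Set.mem_iUnion]
    exact ⟨plays (fun s => P s ω) e t, Finset.mem_Icc.2 ⟨plays_pos, hs⟩, t, rfl, by linarith⟩
  refine (measure_mono hsub).trans ((measure_biUnion_finset_le _ _).trans ?_)
  have hterm : ∀ n ∈ Finset.Icc 1 s, Pr {ω | ∃ t, plays (fun s => P s ω) e t = n ∧
      empMean (fun e s => X e s ω) (fun s => P s ω) t e ≤
        μ e - Real.sqrt (2 * Real.log s / n)} ≤ ENNReal.ofReal (1 / (s : ℝ) ^ 4) := by
    intro n hn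
    obtain ⟨hn1, hns⟩ := Finset.mem_Icc.1 hn
    have hn0 : (0 : ℝ) < n := by exact_mod_cast hn1
    have hs0 : (0 : ℝ) < s := by exact_mod_cast hn1.trans hns
    refine (h.measure_le_sub_le hX e n (Real.sqrt_nonneg _)).trans (ENNReal.ofReal_le_ofReal ?_)
    rw [Real.sq_sqrt (by positivity),
      show -(2 * (n : ℝ) * (2 * Real.log s / n)) = -((4 : ℕ) * Real.log s) by
        field_simp; push_cast; ring,
      Real.exp_neg, Real.exp_nat_mul, Real.exp_log hs0, one_div]
  refine (Finset.sum_le_card_nsmul _ _ _ hterm).trans ?_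
  rw [Nat.card_Icc, Nat.add_sub_cancel, ENNReal.ofReal_mul (Nat.cast_nonneg _),
    ENNReal.ofReal_natCast, nsmul_eq_mul]

/-- Almost every path is typical, for a threshold that is integrable. -/
lemma IsMAUB.exists_isTypicalPath (h : IsMAUB M ℱ X L q N P) (hX : IsEnvironment Pr ℱ X μ)
    {ε : ℝ} (hε : 0 < ε) :
    ∃ V : Ω → ℝ, Integrable V Pr ∧ (∀ ω, 0 ≤ V ω) ∧
      ∀ᵐ ω ∂Pr, IsTypicalPath μ ε (V ω) (fun e t => X e t ω) (fun t => P t ω) := by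
  have hD := fun e => exists_lintegral_ne_top_of_tsum
    (fun n => h.measure_abs_ge_le hX e n hε.le) (by
      have hs := (Real.summable_pow_mul_exp_neg_nat_mul 1
        (by positivity : 0 < 2 * ε ^ 2)).mul_left 2
      refine hs.congr fun n => ?_
      rw [pow_one, show -(2 * ε ^ 2) * (n : ℝ) = -(2 * n * ε ^ 2) by ring]
      ring)
  have hU := fun e => exists_lintegral_ne_top_of_tsum
    (fun s => h.measure_index_lt_le hX e s) (by
      refine (Real.summable_one_div_nat_pow.2 one_lt_two).congr fun s => ?_
      rcases eq_or_ne (s : ℝ) 0 with h0 | h0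
      · simp [h0]
      · field_simp)
  choose W₁ hW₁m hW₁i hW₁ using hD
  choose W₂ hW₂m hW₂i hW₂ using hU
  set W : Ω → ENNReal := fun ω => ∑ e, (W₁ e ω + W₂ e ω) with hW
  have hWm : Measurable W := Finset.measurable_sum _ fun e _ => (hW₁m e).add (hW₂m e)
  have hWi : ∫⁻ ω, W ω ∂Pr ≠ ⊤ := by
    rw [hW, lintegral_finsetSum (f := fun e ω => W₁ e ω + W₂ e ω) _
      fun e _ => (hW₁m e).add (hW₂m e)]
    refine ENNReal.sum_ne_top.2 fun e _ => ?_
    rw [lintegral_add_left (hW₁m e)]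
    exact ENNReal.add_ne_top.2 ⟨hW₁i e, hW₂i e⟩
  have hle : ∀ e ω, W₁ e ω + W₂ e ω ≤ W ω := fun e ω =>
    Finset.single_le_sum (f := fun e => W₁ e ω + W₂ e ω) (fun _ _ => zero_le) (Finset.mem_univ e)
  refine ⟨fun ω => (W ω).toReal, integrable_toReal_of_lintegral_ne_top hWm.aemeasurable hWi,
    fun ω => ENNReal.toReal_nonneg, ?_⟩
  filter_upwards [ae_lt_top hWm hWi] with ω hω
  have hbound : ∀ n : ℕ, (n : ENNReal) ≤ W ω → (n : ℝ) ≤ (W ω).toReal := fun n hn => by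
    have := ENNReal.toReal_mono hω.ne hn
    simpa using this
  constructor
  · intro e t hV
    by_contra! hdev
    exact absurd hV (not_lt.2 (hbound _ (((hW₁ e _ ω ⟨t, rfl, hdev⟩).trans
      le_self_add).trans (hle e ω))))
  · intro e t s hV hs
    by_contra! hlt
    exact absurd hV (not_lt.2 (hbound _ (((hW₂ e _ ω ⟨t, hs, hlt⟩).trans
      le_add_self).trans (hle e ω))))

end Deviation

/-! ### Expected regret -/

section ExpectedRegret

variable {α : Type*} [Fintype α] [DecidableEq α] {M : Matroid α} {μ : α → ℝ} {Bs : Finset α}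
  {Ω : Type*} [mΩ : MeasurableSpace Ω] {Pr : Measure Ω} {ℱ : Filtration ℕ mΩ}
  {X : α → ℕ → Ω → ℝ} {L : ℕ → Ω → Finset α} {q : ℕ → Ω → List α}
  {N : ℕ → Ω → Finset (Finset α)} {P : ℕ → Ω → Finset α}

lemma IsMAUB.integrable_regret [IsFiniteMeasure Pr] (h : IsMAUB M ℱ X L q N P) (μ : α → ℝ)
    (T : ℕ) : Integrable (fun ω => regret M μ (fun t => P t ω) T) Pr := by
  refine (integrable_const _).add (integrable_finsetSum _ fun s hs => ?_)
  obtain ⟨t, rfl⟩ : ∃ t, s = t + 1 := ⟨s - 1, by have := (Finset.mem_Icc.1 hs).1; omega⟩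
  have heq : (fun ω => optValue M μ - value μ (P (t + 1) ω)) = fun ω =>
      ∑ J : Finset α, {ω | P (t + 1) ω = J}.indicator (fun _ => optValue M μ - value μ J) ω := by
    ext ω
    simp [Set.indicator_apply]
  rw [heq]
  exact integrable_finsetSum _ fun J _ =>
    (integrable_const _).indicator (ℱ.le t _ (h.measurableSet_played_eq t J))

lemma IsExecution.regret_nonneg {x : α → ℕ → ℝ} {L : ℕ → Finset α} {q : ℕ → List α}
    {N : ℕ → Finset (Finset α)} {P : ℕ → Finset α} (h : IsExecution M x L q N P)
    (hE : M.E = Set.univ) (hM : M.Loopless) (μ : α → ℝ) (T : ℕ) : 0 ≤ regret M μ P T := by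
  refine add_nonneg (Finset.sum_nonneg fun e _ => sub_nonneg.2 (value_le_optValue μ ?_))
    (Finset.sum_nonneg fun s hs => sub_nonneg.2 (value_le_optValue μ ?_))
  · rw [Finset.coe_singleton]
    exact M.subsingleton_indep (by simp) (by simp [hE])
  · obtain ⟨t, rfl⟩ : ∃ t, s = t + 1 := ⟨s - 1, by have := (Finset.mem_Icc.1 hs).1; omega⟩
    exact (h.isBase_played t).indep

/-- The expected regret exceeds its logarithmic part by a bounded amount. -/
lemma IsMAUB.exists_integral_regret_le [IsProbabilityMeasure Pr] (h : IsMAUB M ℱ X L q N P)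
    (hX : IsEnvironment Pr ℱ X μ) (hE : M.E = Set.univ) (hM : M.Loopless) (hμ_pos : ∀ e, 0 < μ e)
    (hμ : Function.Injective μ) (hBs : M.IsBase (Bs : Set α))
    (hmax : ∀ I : Finset α, M.Indep (I : Set α) → I ≠ Bs → value μ I < value μ Bs) :
    ∃ C : ℝ, ∀ T : ℕ, ∫ ω, regret M μ (fun t => P t ω) T ∂Pr ≤
      (∑ e ∈ Finset.univ \ Bs, 8 / gap M Bs μ e) * Real.log T + C := by
  obtain ⟨ε, hε0, hε⟩ := exists_isSeparated μ
  obtain ⟨C, hC⟩ := exists_regret_le hE hM hμ_pos hμ hBs hmax hε0 hε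
  obtain ⟨V, hVi, hV0, hV⟩ := h.exists_isTypicalPath hX hε0
  refine ⟨C * (1 + ∫ ω, V ω ∂Pr), fun T => ?_⟩
  have h1 : Integrable (fun ω => 1 + V ω) Pr := (integrable_const _).add hVi
  calc ∫ ω, regret M μ (fun t => P t ω) T ∂Pr
      ≤ ∫ ω, ((∑ e ∈ Finset.univ \ Bs, 8 / gap M Bs μ e) * Real.log T + C * (1 + V ω)) ∂Pr := by
        refine integral_mono_ae (h.integrable_regret μ T)
          ((integrable_const _).add (h1.const_mul C)) ?_
        filter_upwards [hV] with ω hω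
        exact hC _ _ _ _ _ _ (hV0 ω) (h.execution ω) hω T
    _ = _ := by
        rw [integral_add (integrable_const _) (h1.const_mul C), integral_const_mul C,
          integral_add (integrable_const _) hVi]
        simp

end ExpectedRegret

section Gaps

variable {α : Type*} [Fintype α] [DecidableEq α] {M : Matroid α} {μ : α → ℝ} {Bs : Finset α}

lemma card_sub_rank_eq (hBs : M.IsBase (Bs : Set α)) :
    (Fintype.card α : ℝ) - rank M = (Finset.univ \ Bs).card := by
  rw [rank_eq_card hBs, Finset.cast_card_sdiff (Finset.subset_univ _), Finset.card_univ]

lemma minGap_pos (hgap : ∀ e, e ∉ Bs → 0 < gap M Bs μ e) (hne : Bs ≠ Finset.univ) :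
    0 < minGap M Bs μ := by
  obtain ⟨e, he⟩ : ∃ e, e ∉ Bs := by
    by_contra! hall
    exact hne (Finset.eq_univ_iff_forall.2 hall)
  have : Nonempty {e : α // e ∉ Bs} := ⟨⟨e, he⟩⟩
  obtain ⟨e', he'⟩ := exists_eq_ciInf_of_finite (f := fun e : {e : α // e ∉ Bs} => gap M Bs μ e.1)
  rw [minGap, ← he']
  exact hgap _ e'.2

lemma minGap_le {e : α} (he : e ∉ Bs) : minGap M Bs μ ≤ gap M Bs μ e :=
  ciInf_le (f := fun e : {e : α // e ∉ Bs} => gap M Bs μ e.1) (Set.finite_range _).bddBelow ⟨e, he⟩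

lemma sum_div_gap_le (hBs : M.IsBase (Bs : Set α)) (hgap : ∀ e, e ∉ Bs → 0 < gap M Bs μ e) :
    ∑ e ∈ Finset.univ \ Bs, 8 / gap M Bs μ e ≤
      8 * (((Fintype.card α : ℝ) - rank M) / minGap M Bs μ) := by
  rw [card_sub_rank_eq hBs]
  rcases eq_or_ne Bs Finset.univ with rfl | hne
  · simp
  have hpos := minGap_pos hgap hne
  calc ∑ e ∈ Finset.univ \ Bs, 8 / gap M Bs μ e
      ≤ (Finset.univ \ Bs).card • (8 / minGap M Bs μ) := by
        refine Finset.sum_le_card_nsmul _ _ _ fun e he => ?_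
        gcongr
        exact minGap_le (Finset.mem_sdiff.1 he).2
    _ = _ := by
        rw [nsmul_eq_mul]
        ring

end Gaps

end MAUB
theorem mainTheorem3 {α : Type*} [Fintype α] [DecidableEq α]
    (M : Matroid α) (hE : M.E = Set.univ) (hM : M.Loopless)
    (μ : α → ℝ) (hμ_pos : ∀ e, 0 < μ e) (hμ_inj : Function.Injective μ)
    (Bs : Finset α) (hBs : M.IsBase (Bs : Set α))
    (hBs_max : ∀ I : Finset α, M.Indep (I : Set α) → I ≠ Bs → MAUB.value μ I < MAUB.value μ Bs)
    {Ω : Type*} [mΩ : MeasurableSpace Ω] (Pr : Measure Ω) [IsProbabilityMeasure Pr]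
    (ℱ : Filtration ℕ mΩ) (X : α → ℕ → Ω → ℝ) (hX : MAUB.IsEnvironment Pr ℱ X μ)
    (L : ℕ → Ω → Finset α) (q : ℕ → Ω → List α) (N : ℕ → Ω → Finset (Finset α))
    (P : ℕ → Ω → Finset α) (hrun : MAUB.IsMAUB M ℱ X L q N P) :
    -- the gaps are well defined and positive
    (∀ e, e ∉ Bs → MAUB.sigma M Bs μ e ∈ MAUB.exchangeable M Bs e ∧ 0 < MAUB.gap M Bs μ e) ∧
    (∀ T, Integrable (fun ω => MAUB.regret M μ (fun t => P t ω) T) Pr) ∧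
    -- the expected regret is at most `∑ 8 / gap * log T + o(log T)`
    (∃ r : ℕ → ℝ, r =o[atTop] (fun T : ℕ => Real.log T) ∧
      ∀ T : ℕ, ∫ ω, MAUB.regret M μ (fun t => P t ω) T ∂Pr ≤
        (∑ e ∈ Finset.univ \ Bs, 8 / MAUB.gap M Bs μ e) * Real.log T + r T) ∧
    -- the comparison with `(|E| - D) / Δ_min`
    (∑ e ∈ Finset.univ \ Bs, 8 / MAUB.gap M Bs μ e ≤
      8 * (((Fintype.card α : ℝ) - MAUB.rank M) / MAUB.minGap M Bs μ)) ∧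
    -- both `O`-bounds, unless `E` itself is the only base and both bounds vanish
    (Bs ≠ Finset.univ →
      ((fun T : ℕ => ∫ ω, MAUB.regret M μ (fun t => P t ω) T ∂Pr) =O[atTop]
        fun T : ℕ => (∑ e ∈ Finset.univ \ Bs, 8 / MAUB.gap M Bs μ e) * Real.log T) ∧
      ((fun T : ℕ => ∫ ω, MAUB.regret M μ (fun t => P t ω) T ∂Pr) =O[atTop]
        fun T : ℕ => ((Fintype.card α : ℝ) - MAUB.rank M) / MAUB.minGap M Bs μ * Real.log T)) := by
  have hgap : ∀ e, e ∉ Bs → 0 < MAUB.gap M Bs μ e := fun e he =>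
    MAUB.gap_pos hE hM hBs hBs_max he
  obtain ⟨C, hC⟩ := hrun.exists_integral_regret_le hX hE hM hμ_pos hμ_inj hBs hBs_max
  have hconst : (fun _ : ℕ => C) =o[atTop] fun T : ℕ => Real.log T :=
    Real.isLittleO_const_log_atTop.comp_tendsto tendsto_natCast_atTop_atTop
  refine ⟨fun e he => ⟨MAUB.sigma_mem (MAUB.exchangeable_nonempty hE hM hBs he), hgap e he⟩,
    hrun.integrable_regret μ, ⟨fun _ => C, hconst, hC⟩, MAUB.sum_div_gap_le hBs hgap, fun hne => ?_⟩
  have hO : (fun T : ℕ => ∫ ω, MAUB.regret M μ (fun t => P t ω) T ∂Pr) =O[atTop]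
      fun T : ℕ => Real.log T := by
    refine IsBigO.trans (IsBigO.of_bound 1 (Eventually.of_forall fun T => ?_))
      (((isBigO_refl (fun T : ℕ => Real.log T) atTop).const_mul_left
        (∑ e ∈ Finset.univ \ Bs, 8 / MAUB.gap M Bs μ e)).add hconst.isBigO)
    have h0 : 0 ≤ ∫ ω, MAUB.regret M μ (fun t => P t ω) T ∂Pr :=
      integral_nonneg fun ω => (hrun.execution ω).regret_nonneg hE hM μ T
    rw [one_mul, Real.norm_of_nonneg h0]
    exact (hC T).trans (le_abs_self _)
  obtain ⟨e, he⟩ : ∃ e, e ∉ Bs := by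
    by_contra! hall
    exact hne (Finset.eq_univ_iff_forall.2 hall)
  have hmem : e ∈ Finset.univ \ Bs := by simpa using he
  refine ⟨hO.const_mul_right (ne_of_gt (Finset.sum_pos (fun e he => ?_) ⟨e, hmem⟩)),
    hO.const_mul_right (ne_of_gt (div_pos ?_ (MAUB.minGap_pos hgap hne)))⟩
  · exact div_pos (by norm_num) (hgap e (Finset.mem_sdiff.1 he).2)
  · rw [MAUB.card_sub_rank_eq hBs]
    exact_mod_cast Finset.card_pos.2 ⟨e, hmem⟩
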